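/- **Setting.** Let $\mathrm{Types}$ be a finite type hierarchy: a finite complete lattice in which $t\sqsubseteq t'$ means that $t$ is more general than $t'$ ($t$ subsumes $t'$), with $\bot$ the most general and $\top$ the inconsistent type. Let $\mathrm{Feats}$ be a finite set of features, $\mathrm{Nodes}$ a set with a fixed typing $\theta:\mathrm{Nodes}\to\mathrm{Types}$, and $\mathrm{Words}$ a set; paths are the elements of $\mathrm{Feats}^*$. A *multi-rooted structure* (MRS) is a finite directed graph on nodes, with arcs given by a partial function $\delta:Q\times\mathrm{Feats}\to Q$, and a repetition-free list of roots from which all nodes are reachable; its length is the number of roots. A *typed feature structure* (TFS) is an MRS of length 1. A *pre-AMRS* is $A=\langle\{1,\dots,n\},\Pi,\Theta,\approx\rangle$ with $\Pi\subseteq\{1,\dots,n\}\times\mathrm{Feats}^*$ containing some $(i,\pi)$ for each $i\le n$, $\Theta:\Pi\to\mathrm{Types}$ and $\approx\ \subseteq\Pi\times\Pi$; $|A|=n$ is its length. It is an *abstract multi-rooted structure* (AMRS) if * $\Pi$ is prefix-closed; * it is fusion-closed: $(i,\pi\alpha),(i',\pi'\alpha')\in\Pi$ and $(i,\pi)\approx(i',\pi')$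 imply $(i,\pi\alpha'),(i',\pi'\alpha)\in\Pi$, $(i,\pi\alpha')\approx(i',\pi'\alpha')$ and $(i',\pi'\alpha)\approx(i,\pi\alpha)$; * $\approx$ is an equivalence relation of finite index that $\Theta$ respects. $\mathrm{Abs}(\sigma)$ is the AMRS of an MRS $\sigma$: $(i,\pi)\in\Pi$ iff the path $\pi$ is defined from the $i$-th root, $\Theta(i,\pi)$ is the type of the node reached, and $\approx$ means reaching the same node. $\lambda$ is the empty AMRS, and $A\cdot B$ is concatenation without sharing. $A^{j..k}$ is the sub-structure with indices $j,\dots,k$, renumbered from 1 ($\lambda$ if $k<j$), and $A^j=A^{j..j}$. $A\sqsubseteq B$ means $|A|=|B|$, $\Pi_A\subseteq\Pi_B$, $\approx_A\subseteq\approx_B$ and $\Theta_A\sqsubseteq\Theta_B$ on $\Pi_A$. $Cl$ is the least prefix- and fusion-closed extension (new paths typed $\bot$), $Eq$ replaces $\approx$ by the least equivalence relation on $\Pi$ containing it, and $Ty$ replaces $\Theta(p)$ by $\bigsqcup_{q\approx p}\Theta(q)$; let $\overline C=Ty(Eq(Cl(C)))$. For $J\subseteq\{1,\dots,|A|\}$,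 $J\subseteq\{1,\dots,|B|\}$, the *unification* $(A,J)\sqcup B$ is $\overline C$, where $C$ is obtained from $A$ by adding the paths $(i,\pi)\in\Pi_B$ with $i\in J$, taking joins of types, and adding the pairs of $\approx_B$ with both indices in $J$. If $|B|=1$ and $J=\{j\}$, index $1$ of $B$ is matched with $j$ instead. A unification *fails* ($=\top$) if its result has a path typed $\top$. **Grammars.** A grammar $G=(\mathcal R,A_s)$ is a finite set $\mathcal R$ of rules (MRSs of positive length, the last element being the head and the others the body) with a start symbol $A_s$, a TFS. A lexicon assigns to each $x\in\mathrm{Words}$ a set $\mathrm{Cat}(x)$ of TFSs. For $w=w_1\cdots w_n$, $PT_w(1,n)$ is the set of all $\mathrm{Abs}(A_1)\cdots\mathrm{Abs}(A_n)$ with $A_i\in\mathrm{Cat}(w_i)$ ($\{\lambda\}$ if $n=0$). For AMRSs, $A\to B$ iff there are $\rho\in\mathcal R$, an AMRS $R\sqsupseteq\mathrm{Abs}(\rho)$ of length $r$ and $1\le j\le|A|$ such that, all unifications succeeding, * $A=(A,\{j\})\sqcup R^r$ and $R=(R,\{r\})\sqcup A^j$; * $B$ is unchanged on the positions $j,\dots,j+r-2$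 by unifying $R^{1..r-1}$ into them, and $R=(R,\{1,\dots,r-1\})\sqcup B^{j..j+r-2}$; * $B=\overline{B'}$, where $B'$ is $A$ with its $j$-th element replaced by the body of $R$. Here the remaining paths of $A$ and the paths of the body keep their types and their $\approx_A$, $\approx_R$, and a path $p$ from $A$ and a path $q$ from the body are related (in both orders) iff $p\approx_A(j,\pi)$ and $(r,\pi)\approx_R q$ for some $\pi$. Let $\to^*$ be the reflexive transitive closure. $A\leadsto B$ iff there are AMRSs $A',B'$ with $|A'|=|A|$, $(A,\{1,\dots,|A|\})\sqcup A'\neq\top$, $B\sqsubseteq B'$ and $A'\to^*B'$. The language is $L(G)=\{w\in\mathrm{Words}^*\mid \mathrm{Abs}(A_s)\leadsto B\text{ for some }B\in PT_w(1,|w|)\}$. **Parsing.** An item is $[i,A,j,c]$ with $i\le j$ in $\mathbb N$, $A$ an AMRS, $c\in\{\mathrm{Act},\mathrm{Comp}\}$. For $w=w_1\cdots w_n$ and a set $I$ of items, $T_{G,w}(I)$ consists of the following items, where $\rho\in\mathcal R$, $R=\mathrm{Abs}(\rho)$, $m=|R|$, and unifications have to succeed: 1. $[i_\alpha,C^{1..k+1},j_\beta,\mathrm{Act}]$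 if $m>1$, $k<m-1$, $[i_\alpha,A_\alpha,j_\alpha,\mathrm{Act}]\in I$, $|A_\alpha|=k$, $[i_\beta,A_\beta,j_\beta,\mathrm{Comp}]\in I$, $|A_\beta|=1$, $j_\alpha=i_\beta$, $B=(R,\{1,\dots,k\})\sqcup A_\alpha$, $C=(B,\{k+1\})\sqcup A_\beta$; 2. $[i_\alpha,C^m,j_\alpha,\mathrm{Comp}]$ if $m>1$, $[i_\alpha,A_\alpha,j_\alpha,\mathrm{Act}]\in I$, $|A_\alpha|=m-1$, $C=(R,\{1,\dots,m-1\})\sqcup A_\alpha$; 3. $[i,\lambda,i,\mathrm{Act}]$ for $0\le i\le n$; 4. $[i,R,i,\mathrm{Comp}]$ for $0\le i\le n$ if $m=1$; 5. $[i-1,\mathrm{Abs}(A),i,\mathrm{Comp}]$ for $0<i\le n$, $A\in\mathrm{Cat}(w_i)$. The computation triggered by $w$ is $I_0=\emptyset$, $I_{m+1}=T_{G,w}(I_m)$. It is *successful* if for some $m$ there is $[0,A,n,\mathrm{Comp}]\in I_m$ with $|A|=1$ and $A\sqcup\mathrm{Abs}(A_s)\ne\top$. **Theorem.** For every grammar $G$,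 every lexicon $\mathrm{Cat}$ and every $w\in\mathrm{Words}^*$: if $w\in L(G)$ then the computation triggered by $w$ is successful. -/

import Mathlib

/-! Typed feature structures, (abstract) multi-rooted structures, unification in context,
grammars, derivation, languages, and the bottom-up chart parsing operator.

Conventions. `Types` is a complete lattice: `x ≤ y` reads "`x` subsumes (is more general than)
`y`", `⊔` is type unification, `⊥` is the most general type and `⊤` the inconsistent type.
Roots and indices are numbered from `1`. A path is a list of features. -/

namespace TFSParsing

universe u v w z

/-! ### Concrete structures -/

/-- Extension of a partial transition function from features to paths. -/
def run {Feats : Type u} {Nodes : Type w} (δ : Nodes → Feats → Option Nodes) :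
    Nodes → List Feats → Option Nodes
  | q, [] => some q
  | q, f :: π => (δ q f).bind fun q' => run δ q' π

/-- A typed feature structure: a finite rooted graph all of whose nodes are accessible from the
root. The typing of nodes is a globally fixed function `θ : Nodes → Types`, which is why it is
not part of the structure. -/
structure TFS (Feats : Type u) (Nodes : Type w) where
  Q : Set Nodes
  finite : Q.Finite
  root : Nodes
  root_mem : root ∈ Q
  δ : Nodes → Feats → Option Nodes
  δ_mem : ∀ q f q', δ q f = some q' → q ∈ Q ∧ q' ∈ Q
  accessible : ∀ q ∈ Q, ∃ π, run δ root π = some q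

/-- A multi-rooted structure. -/
structure MRS (Feats : Type u) (Nodes : Type w) where
  Q : Set Nodes
  finite : Q.Finite
  roots : List Nodes
  nodup : roots.Nodup
  roots_mem : ∀ q ∈ roots, q ∈ Q
  δ : Nodes → Feats → Option Nodes
  δ_mem : ∀ q f q', δ q f = some q' → q ∈ Q ∧ q' ∈ Q
  accessible : ∀ q ∈ Q, ∃ r ∈ roots, ∃ π, run δ r π = some q

/-- A feature structure is a multi-rooted structure with one root. -/
def TFS.toMRS {Feats : Type u} {Nodes : Type w} (A : TFS Feats Nodes) : MRS Feats Nodes where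
  Q := A.Q
  finite := A.finite
  roots := [A.root]
  nodup := List.nodup_singleton _
  roots_mem := by
    intro q hq
    rw [List.mem_singleton] at hq
    exact hq ▸ A.root_mem
  δ := A.δ
  δ_mem := A.δ_mem
  accessible := fun q hq => ⟨A.root, List.mem_singleton.2 rfl, A.accessible q hq⟩

/-- The node reached from the `i`-th root (`1 ≤ i`) along the path `π`, for `p = (i, π)`. -/
def MRS.node {Feats : Type u} {Nodes : Type w} (σ : MRS Feats Nodes) (p : ℕ × List Feats) :
    Option Nodes :=
  if p.1 = 0 then none else (σ.roots[p.1 - 1]?).bind fun r => run σ.δ r p.2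

/-! ### Abstract multi-rooted structures -/

/-- A pre-AMRS `⟨Ind, Π, Θ, ≈⟩` with `Ind = {1, …, len}`. The type assignment `Θ`, a total
function on `Π`, is represented by a function on all indexed paths that takes the dummy value `⊥`
outside `Π`, so that equality of structures is equality of `Ind`, `Π`, `Θ` and `≈`. -/
@[ext]
structure PreAMRS (Feats : Type u) (Types : Type v) [CompleteLattice Types] where
  len : ℕ
  paths : Set (ℕ × List Feats)
  typ : ℕ × List Feats → Types
  rel : ℕ × List Feats → ℕ × List Feats → Prop
  mem_ind : ∀ p ∈ paths, 1 ≤ p.1 ∧ p.1 ≤ len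
  exists_path : ∀ i, 1 ≤ i → i ≤ len → ∃ π, (i, π) ∈ paths
  typ_outside : ∀ p, p ∉ paths → typ p = ⊥
  rel_mem : ∀ p q, rel p q → p ∈ paths ∧ q ∈ paths

/-- If `πα ∈ Π` then `π ∈ Π`. -/
def PrefixClosed {Feats : Type u} (P : Set (ℕ × List Feats)) : Prop :=
  ∀ i π α, (i, π ++ α) ∈ P → (i, π) ∈ P

/-- Fusion-closure. -/
def FusionClosed {Feats : Type u} (P : Set (ℕ × List Feats))
    (r : ℕ × List Feats → ℕ × List Feats → Prop) : Prop :=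
  ∀ i i' π π' α α', (i, π ++ α) ∈ P → (i', π' ++ α') ∈ P → r (i, π) (i', π') →
    (i, π ++ α') ∈ P ∧ (i', π' ++ α) ∈ P ∧
      r (i, π ++ α') (i', π' ++ α') ∧ r (i', π' ++ α) (i, π ++ α)

/-- An abstract multi-rooted structure. An abstract feature structure is an AMRS of length 1. -/
structure AMRS (Feats : Type u) (Types : Type v) [CompleteLattice Types] extends
    PreAMRS Feats Types where
  prefixClosed : PrefixClosed paths
  fusionClosed : FusionClosed paths rel
  refl : ∀ p ∈ paths, rel p p
  symm : ∀ p q, rel p q → rel q p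
  trans : ∀ p q s, rel p q → rel q s → rel p s
  finite_index : {S : Set (ℕ × List Feats) | ∃ p ∈ paths, S = {q | rel p q}}.Finite
  typ_rel : ∀ p q, rel p q → typ p = typ q

namespace PreAMRS

variable {Feats : Type u} {Types : Type v} [CompleteLattice Types]

/-- Subsumption of abstract structures. -/
def Subsumes (A B : PreAMRS Feats Types) : Prop :=
  A.len = B.len ∧ A.paths ⊆ B.paths ∧ (∀ p q, A.rel p q → B.rel p q) ∧
    ∀ p ∈ A.paths, A.typ p ≤ B.typ p

/-- Some path carries the inconsistent type. A unification fails if its result is inconsistent,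
which is written `A ⊔ B = ⊤`. -/
def Inconsistent (A : PreAMRS Feats Types) : Prop :=
  ∃ p ∈ A.paths, A.typ p = ⊤

/-- The empty structure `λ`. -/
def empty : PreAMRS Feats Types where
  len := 0
  paths := ∅
  typ := fun _ => ⊥
  rel := fun _ _ => False
  mem_ind := fun p hp => hp.elim
  exists_path := fun i h1 h2 => absurd (h1.trans h2) (by decide)
  typ_outside := fun _ _ => rfl
  rel_mem := fun _ _ h => h.elim

/-- The sub-structure `A^{j..k}` induced by the indices `{j, …, k}` of `A`, renumbered from `1`
(for `1 ≤ j` and `k ≤ len`; it is `λ` if `k < j`). -/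
def sub (A : PreAMRS Feats Types) (j k : ℕ) : PreAMRS Feats Types where
  len := min k A.len - (j - 1)
  paths := {p | (1 ≤ p.1 ∧ p.1 ≤ min k A.len - (j - 1)) ∧ (p.1 + (j - 1), p.2) ∈ A.paths}
  typ := fun p => ⨆ _ : 1 ≤ p.1 ∧ p.1 ≤ min k A.len - (j - 1), A.typ (p.1 + (j - 1), p.2)
  rel := fun p q => (1 ≤ p.1 ∧ p.1 ≤ min k A.len - (j - 1)) ∧
    (1 ≤ q.1 ∧ q.1 ≤ min k A.len - (j - 1)) ∧
    A.rel (p.1 + (j - 1), p.2) (q.1 + (j - 1), q.2)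
  mem_ind := fun _ hp => hp.1
  exists_path := by
    intro i h1 h2
    obtain ⟨π, hπ⟩ := A.exists_path (i + (j - 1)) (by omega) (by omega)
    exact ⟨π, ⟨h1, h2⟩, hπ⟩
  typ_outside := by
    intro p hp
    refine iSup_eq_bot.2 fun h => ?_
    exact A.typ_outside _ fun hm => hp ⟨h, hm⟩
  rel_mem := by
    rintro p q ⟨hp, hq, h⟩
    exact ⟨⟨hp, (A.rel_mem _ _ h).1⟩, ⟨hq, (A.rel_mem _ _ h).2⟩⟩

/-- Concatenation `A · B`; the two parts share nothing. -/
def concat (A B : PreAMRS Feats Types) : PreAMRS Feats Types where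
  len := A.len + B.len
  paths := {p | p ∈ A.paths ∨ (A.len < p.1 ∧ (p.1 - A.len, p.2) ∈ B.paths)}
  typ := fun p => if p.1 ≤ A.len then A.typ p else B.typ (p.1 - A.len, p.2)
  rel := fun p q => A.rel p q ∨
    (A.len < p.1 ∧ A.len < q.1 ∧ B.rel (p.1 - A.len, p.2) (q.1 - A.len, q.2))
  mem_ind := by
    rintro p (hp | ⟨h, hp⟩)
    · have := A.mem_ind p hp
      omega
    · have := B.mem_ind _ hp
      dsimp only at this
      omega
  exists_path := by
    intro i h1 h2
    by_cases h : i ≤ A.len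
    · obtain ⟨π, hπ⟩ := A.exists_path i h1 h
      exact ⟨π, Or.inl hπ⟩
    · obtain ⟨π, hπ⟩ := B.exists_path (i - A.len) (by omega) (by omega)
      exact ⟨π, Or.inr ⟨by dsimp only; omega, hπ⟩⟩
  typ_outside := by
    intro p hp
    by_cases h : p.1 ≤ A.len
    · rw [if_pos h]
      exact A.typ_outside p fun hm => hp (Or.inl hm)
    · rw [if_neg h]
      exact B.typ_outside _ fun hm => hp (Or.inr ⟨by omega, hm⟩)
  rel_mem := by
    rintro p q (h | ⟨h1, h2, h⟩)
    · exact ⟨Or.inl (A.rel_mem _ _ h).1, Or.inl (A.rel_mem _ _ h).2⟩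
    · exact ⟨Or.inr ⟨h1, (B.rel_mem _ _ h).1⟩, Or.inr ⟨h2, (B.rel_mem _ _ h).2⟩⟩

/-- `(P, r)` is a prefix- and fusion-closed extension of the paths and the relation of `A`. -/
def IsClosedExtension (A : PreAMRS Feats Types) (P : Set (ℕ × List Feats))
    (r : ℕ × List Feats → ℕ × List Feats → Prop) : Prop :=
  A.paths ⊆ P ∧ (∀ p q, A.rel p q → r p q) ∧
    (∀ p ∈ P, 1 ≤ p.1 ∧ p.1 ≤ A.len) ∧ (∀ p q, r p q → p ∈ P ∧ q ∈ P) ∧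
    PrefixClosed P ∧ FusionClosed P r

/-- A closed extension always exists. -/
theorem isClosedExtension_full (A : PreAMRS Feats Types) :
    A.IsClosedExtension {p | 1 ≤ p.1 ∧ p.1 ≤ A.len}
      (fun p q => (1 ≤ p.1 ∧ p.1 ≤ A.len) ∧ (1 ≤ q.1 ∧ q.1 ≤ A.len)) :=
  ⟨A.mem_ind, fun p q h => ⟨A.mem_ind p (A.rel_mem p q h).1, A.mem_ind q (A.rel_mem p q h).2⟩,
    fun _ h => h, fun _ _ h => h, fun _ _ _ h => h,
    fun _ _ _ _ _ _ h h' _ => ⟨h, h', ⟨h, h'⟩, ⟨h', h⟩⟩⟩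

/-- `Cl`: the least prefix- and fusion-closed extension, obtained as the intersection of all of
them. The types of old paths are kept and new paths get the least type `⊥`. -/
def cl (A : PreAMRS Feats Types) : PreAMRS Feats Types where
  len := A.len
  paths := {p | ∀ P r, A.IsClosedExtension P r → p ∈ P}
  typ := A.typ
  rel := fun p q => ∀ P r, A.IsClosedExtension P r → r p q
  mem_ind := fun _ hp => hp _ _ A.isClosedExtension_full
  exists_path := by
    intro i h1 h2
    obtain ⟨π, hπ⟩ := A.exists_path i h1 h2
    exact ⟨π, fun P r h => h.1 hπ⟩
  typ_outside := fun p hp => A.typ_outside p fun hm => hp fun P r h => h.1 hm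
  rel_mem := fun p q h =>
    ⟨fun P r hc => (hc.2.2.2.1 p q (h P r hc)).1, fun P r hc => (hc.2.2.2.1 p q (h P r hc)).2⟩

/-- `Eq`: the relation is extended to the least equivalence relation on the paths. -/
def eqv (A : PreAMRS Feats Types) : PreAMRS Feats Types where
  len := A.len
  paths := A.paths
  typ := A.typ
  rel := fun p q => p ∈ A.paths ∧ q ∈ A.paths ∧ Relation.EqvGen A.rel p q
  mem_ind := A.mem_ind
  exists_path := A.exists_path
  typ_outside := A.typ_outside
  rel_mem := fun _ _ h => ⟨h.1, h.2.1⟩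

/-- `Ty`: the type of a path becomes the unification of the types of all related paths. -/
def ty (A : PreAMRS Feats Types) : PreAMRS Feats Types where
  len := A.len
  paths := A.paths
  typ := fun p => ⨆ q, ⨆ _ : A.rel q p, A.typ q
  rel := A.rel
  mem_ind := A.mem_ind
  exists_path := A.exists_path
  typ_outside := by
    intro p hp
    refine iSup_eq_bot.2 fun q => iSup_eq_bot.2 fun h => ?_
    exact absurd (A.rel_mem _ _ h).2 hp
  rel_mem := A.rel_mem

/-- The structure `C` underlying the unification of `B` into `A` at the indices `J ⊆ Ind_A`, where
index `i ∈ J` of `A` is matched with index `f i` of `B`. As type assignments are `⊥` outside the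
paths, `Θ_A ⊔ Θ_B` covers the case distinction on which of the two is defined. -/
def preUnify (f : ℕ → ℕ) (A : PreAMRS Feats Types) (J : Set ℕ) (B : PreAMRS Feats Types) :
    PreAMRS Feats Types where
  len := A.len
  paths := A.paths ∪ {p | (1 ≤ p.1 ∧ p.1 ≤ A.len) ∧ p.1 ∈ J ∧ (f p.1, p.2) ∈ B.paths}
  typ := fun p => A.typ p ⊔ ⨆ _ : (1 ≤ p.1 ∧ p.1 ≤ A.len) ∧ p.1 ∈ J, B.typ (f p.1, p.2)
  rel := fun p q => A.rel p q ∨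
    (((1 ≤ p.1 ∧ p.1 ≤ A.len) ∧ p.1 ∈ J) ∧ ((1 ≤ q.1 ∧ q.1 ≤ A.len) ∧ q.1 ∈ J) ∧
      B.rel (f p.1, p.2) (f q.1, q.2))
  mem_ind := by
    rintro p (hp | hp)
    · exact A.mem_ind p hp
    · exact hp.1
  exists_path := by
    intro i h1 h2
    obtain ⟨π, hπ⟩ := A.exists_path i h1 h2
    exact ⟨π, Or.inl hπ⟩
  typ_outside := by
    intro p hp
    rw [A.typ_outside p fun hm => hp (Or.inl hm), bot_sup_eq]
    refine iSup_eq_bot.2 fun h => ?_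
    exact B.typ_outside _ fun hm => hp (Or.inr ⟨h.1, h.2, hm⟩)
  rel_mem := by
    rintro p q (h | ⟨hp, hq, h⟩)
    · exact ⟨Or.inl (A.rel_mem _ _ h).1, Or.inl (A.rel_mem _ _ h).2⟩
    · exact ⟨Or.inr ⟨hp.1, hp.2, (B.rel_mem _ _ h).1⟩,
        Or.inr ⟨hq.1, hq.2, (B.rel_mem _ _ h).2⟩⟩

/-- `(A, J) ⊔ B` with an explicit matching `f` of the indices in `J` with indices of `B`. -/
def unifyVia (f : ℕ → ℕ) (A : PreAMRS Feats Types) (J : Set ℕ) (B : PreAMRS Feats Types) :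
    PreAMRS Feats Types :=
  (preUnify f A J B).cl.eqv.ty

/-- `(A, J) ⊔ B` for an AMRS `B` (with `J ⊆ Ind_A ∩ Ind_B`): equal indices are matched. -/
def unify (A : PreAMRS Feats Types) (J : Set ℕ) (B : PreAMRS Feats Types) :
    PreAMRS Feats Types :=
  unifyVia id A J B

/-- `(A, {j}) ⊔ B` for an abstract feature structure `B`. -/
def unifyAt (A : PreAMRS Feats Types) (j : ℕ) (B : PreAMRS Feats Types) :
    PreAMRS Feats Types :=
  unifyVia (fun _ => 1) A {j} B

/-- Where index `i` of the replacement of the `j`-th element by the body of a structure of length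
`n` comes from: `inl i'` is index `i'` of the original structure, `inr i'` index `i'` of the body.
This is the inverse of the two index maps `i' ↦ i'` (for `i' < j`), `i' ↦ i' + n - 2` (for `j < i'`)
and `i' ↦ i' + j - 1` (for body indices `1 ≤ i' < n`). -/
def origin (j n i : ℕ) : ℕ ⊕ ℕ :=
  if i < j then Sum.inl i
  else if i < j + n - 1 then Sum.inr (i + 1 - j)
  else Sum.inl (i + 2 - n)

/-- The structure `B'` obtained by replacing the `j`-th element of `A` by the body
`R^{1..n-1}` of `R`, `n = len R`. Paths of the rest of `A` and of the body of `R` become reentrant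
if they are linked through a path of the replaced element `A^j` and the same path of the head
`R^n`. -/
def preReplace (A : PreAMRS Feats Types) (j : ℕ) (R : PreAMRS Feats Types)
    (hj : 1 ≤ j ∧ j ≤ A.len) (hR : 1 ≤ R.len) : PreAMRS Feats Types where
  len := A.len + R.len - 2
  paths := {p | match origin j R.len p.1 with
    | Sum.inl i => (i, p.2) ∈ A.paths
    | Sum.inr i => (i, p.2) ∈ R.paths}
  typ := fun p => match origin j R.len p.1 with
    | Sum.inl i => A.typ (i, p.2)
    | Sum.inr i => R.typ (i, p.2)
  rel := fun p q => match origin j R.len p.1, origin j R.len q.1 with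
    | Sum.inl i, Sum.inl i' => A.rel (i, p.2) (i', q.2)
    | Sum.inr i, Sum.inr i' => R.rel (i, p.2) (i', q.2)
    | Sum.inl i, Sum.inr i' => ∃ π, A.rel (i, p.2) (j, π) ∧ R.rel (R.len, π) (i', q.2)
    | Sum.inr i, Sum.inl i' => ∃ π, R.rel (i, p.2) (R.len, π) ∧ A.rel (j, π) (i', q.2)
  mem_ind := by
    rintro ⟨i, π⟩ hp
    simp only [Set.mem_ofPred_eq, origin] at hp
    split_ifs at hp with h1 h2
    · have := A.mem_ind _ hp
      dsimp only at this ⊢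
      omega
    · have := R.mem_ind _ hp
      dsimp only at this ⊢
      omega
    · have := A.mem_ind _ hp
      dsimp only at this ⊢
      omega
  exists_path := by
    intro i h1 h2
    simp only [Set.mem_ofPred_eq, origin]
    split_ifs with h3 h4
    · exact A.exists_path _ (by omega) (by omega)
    · exact R.exists_path _ (by omega) (by omega)
    · exact A.exists_path _ (by omega) (by omega)
  typ_outside := by
    rintro ⟨i, π⟩ hp
    simp only [Set.mem_ofPred_eq] at hp
    dsimp only
    generalize origin j R.len i = o at hp ⊢
    cases o with
    | inl a => exact A.typ_outside _ hp
    | inr a => exact R.typ_outside _ hp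
  rel_mem := by
    rintro ⟨i, π⟩ ⟨i', π'⟩ h
    simp only [Set.mem_ofPred_eq]
    dsimp only at h
    generalize origin j R.len i = o at h ⊢
    generalize origin j R.len i' = o' at h ⊢
    cases o <;> cases o'
    · exact A.rel_mem _ _ h
    · obtain ⟨_, h1, h2⟩ := h
      exact ⟨(A.rel_mem _ _ h1).1, (R.rel_mem _ _ h2).2⟩
    · obtain ⟨_, h1, h2⟩ := h
      exact ⟨(R.rel_mem _ _ h1).1, (A.rel_mem _ _ h2).2⟩
    · exact R.rel_mem _ _ h

/-- The replacement of the `j`-th element of `A` by the body of `R`. -/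
def replace (A : PreAMRS Feats Types) (j : ℕ) (R : PreAMRS Feats Types)
    (hj : 1 ≤ j ∧ j ≤ A.len) (hR : 1 ≤ R.len) : PreAMRS Feats Types :=
  (preReplace A j R hj hR).cl.eqv.ty

end PreAMRS

/-- The abstraction `Abs(σ)` of a multi-rooted structure, for the typing `θ` of the nodes. -/
def MRS.abs {Feats : Type u} {Types : Type v} [CompleteLattice Types] {Nodes : Type w}
    (θ : Nodes → Types) (σ : MRS Feats Nodes) : PreAMRS Feats Types where
  len := σ.roots.length
  paths := {p | ∃ q, σ.node p = some q}
  typ := fun p => (σ.node p).elim ⊥ θ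
  rel := fun p p' => ∃ q, σ.node p = some q ∧ σ.node p' = some q
  mem_ind := by
    rintro p ⟨q, hq⟩
    unfold MRS.node at hq
    split_ifs at hq with h
    obtain ⟨r, hr, -⟩ := Option.bind_eq_some_iff.1 hq
    obtain ⟨hlt, -⟩ := List.getElem?_eq_some_iff.1 hr
    omega
  exists_path := by
    intro i h1 h2
    refine ⟨[], σ.roots[i - 1]'(by omega), ?_⟩
    have hi : i ≠ 0 := by omega
    simp [MRS.node, hi, List.getElem?_eq_getElem (show i - 1 < σ.roots.length by omega), run]
  typ_outside := by
    intro p hp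
    cases h : σ.node p with
    | none => rfl
    | some q => exact absurd ⟨q, h⟩ hp
  rel_mem := fun _ _ ⟨q, h, h'⟩ => ⟨⟨q, h⟩, ⟨q, h'⟩⟩

/-- The abstraction of a feature structure, as an abstract structure of length 1. -/
def TFS.abs {Feats : Type u} {Types : Type v} [CompleteLattice Types] {Nodes : Type w}
    (θ : Nodes → Types) (A : TFS Feats Nodes) : PreAMRS Feats Types :=
  A.toMRS.abs θ

/-! ### Grammars, derivation, languages -/

/-- A grammar: finitely many rules, which are multi-rooted structures of positive length whose last
element is the head, and a start symbol. -/
structure Grammar (Feats : Type u) (Nodes : Type w) where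
  rules : Set (MRS Feats Nodes)
  rules_finite : rules.Finite
  rules_pos : ∀ ρ ∈ rules, 0 < ρ.roots.length
  start : TFS Feats Nodes

section Derivation

variable {Feats : Type u} {Types : Type v} [CompleteLattice Types] {Nodes : Type w}
  {Words : Type z}

/-- The `PT_w(j, k)`: the sequences of (abstracted) categories of the words `w_j, …, w_k`, without
reentrancies among different words; `PT_w(j, k) = {λ}` if `j > k`. -/
def PT (θ : Nodes → Types) (Cat : Words → Set (TFS Feats Nodes)) (ws : List Words) (j k : ℕ) :
    Set (PreAMRS Feats Types) :=
  {B | ∃ As : List (TFS Feats Nodes),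
    List.Forall₂ (fun A x => A ∈ Cat x) As ((ws.drop (j - 1)).take (k + 1 - j)) ∧
    B = (As.map (TFS.abs θ)).foldr PreAMRS.concat PreAMRS.empty}

/-- Strong derivation `A → B`. The equations say that the unifications succeed and do not add
information. The body of `R` occupies the positions `j, …, j + n - 2` of `B`, `n = len R`. -/
def StrongDerives (θ : Nodes → Types) (G : Grammar Feats Nodes) (A B : AMRS Feats Types) : Prop :=
  ∃ ρ ∈ G.rules, ∃ R : AMRS Feats Types, (ρ.abs θ).Subsumes R.toPreAMRS ∧
  ∃ (j : ℕ) (hj : 1 ≤ j ∧ j ≤ A.len) (hR : 1 ≤ R.len),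
    (¬ (A.unifyAt j (R.sub R.len R.len)).Inconsistent ∧
      A.toPreAMRS = A.unifyAt j (R.sub R.len R.len)) ∧
    (¬ (R.unifyAt R.len (A.sub j j)).Inconsistent ∧
      R.toPreAMRS = R.unifyAt R.len (A.sub j j)) ∧
    (¬ (PreAMRS.unifyVia (fun i => i - (j - 1)) B.toPreAMRS (Set.Icc j (j + R.len - 2))
          (R.sub 1 (R.len - 1))).Inconsistent ∧
      B.sub j (j + R.len - 2) =
        (PreAMRS.unifyVia (fun i => i - (j - 1)) B.toPreAMRS (Set.Icc j (j + R.len - 2))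
          (R.sub 1 (R.len - 1))).sub j (j + R.len - 2)) ∧
    (¬ (R.unify (Set.Icc 1 (R.len - 1)) (B.sub j (j + R.len - 2))).Inconsistent ∧
      R.toPreAMRS = R.unify (Set.Icc 1 (R.len - 1)) (B.sub j (j + R.len - 2))) ∧
    B.toPreAMRS = A.replace j R.toPreAMRS hj hR

/-- Derivation `A ⇝ B`: some `A'` of the same length as `A` that unifies with `A` strongly derives,
in zero or more steps, some `B'` that is subsumed by `B`. -/
def Derives (θ : Nodes → Types) (G : Grammar Feats Nodes) (A B : PreAMRS Feats Types) : Prop :=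
  ∃ A' B' : AMRS Feats Types, A'.len = A.len ∧
    ¬ (A.unify (Set.Icc 1 A.len) A'.toPreAMRS).Inconsistent ∧
    B.Subsumes B'.toPreAMRS ∧ Relation.ReflTransGen (StrongDerives θ G) A' B'

/-- The language `L(G)`. -/
def language (θ : Nodes → Types) (Cat : Words → Set (TFS Feats Nodes)) (G : Grammar Feats Nodes) :
    Set (List Words) :=
  {ws | ∃ B ∈ PT θ Cat ws 1 ws.length, Derives θ G (G.start.abs θ) B}

end Derivation

/-! ### Chart parsing -/

/-- The status of an item: active or complete. -/
inductive Status
  | act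
  | comp

/-- An item `[i, A, j, c]`. -/
structure Item (Feats : Type u) (Types : Type v) [CompleteLattice Types] where
  i : ℕ
  A : AMRS Feats Types
  j : ℕ
  c : Status
  le : i ≤ j

section Parsing

variable {Feats : Type u} {Types : Type v} [CompleteLattice Types] {Nodes : Type w}
  {Words : Type z}

/-- `x` arises by moving the dot over an element of the body of a rule. Here and below an item is
created only if the unifications succeed. -/
def DotMove (θ : Nodes → Types) (G : Grammar Feats Nodes) (I : Set (Item Feats Types))
    (x : Item Feats Types) : Prop :=
  ∃ ρ ∈ G.rules, ∃ k : ℕ, 1 < (ρ.abs θ).len ∧ k < (ρ.abs θ).len - 1 ∧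
  ∃ α ∈ I, α.c = Status.act ∧ α.A.len = k ∧
  ∃ β ∈ I, β.c = Status.comp ∧ β.A.len = 1 ∧ α.j = β.i ∧
  ∃ B C : PreAMRS Feats Types,
    B = (ρ.abs θ).unify (Set.Icc 1 k) α.A.toPreAMRS ∧ ¬ B.Inconsistent ∧
    C = B.unifyAt (k + 1) β.A.toPreAMRS ∧ ¬ C.Inconsistent ∧
    x.i = α.i ∧ x.A.toPreAMRS = C.sub 1 (k + 1) ∧ x.j = β.j ∧ x.c = Status.act

/-- `x` arises by completing a rule whose whole body has been recognized. -/
def Completion (θ : Nodes → Types) (G : Grammar Feats Nodes) (I : Set (Item Feats Types))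
    (x : Item Feats Types) : Prop :=
  ∃ ρ ∈ G.rules, 1 < (ρ.abs θ).len ∧
  ∃ α ∈ I, α.c = Status.act ∧ α.A.len = (ρ.abs θ).len - 1 ∧
  ∃ C : PreAMRS Feats Types,
    C = (ρ.abs θ).unify (Set.Icc 1 ((ρ.abs θ).len - 1)) α.A.toPreAMRS ∧ ¬ C.Inconsistent ∧
    x.i = α.i ∧ x.A.toPreAMRS = C.sub (ρ.abs θ).len (ρ.abs θ).len ∧ x.j = α.j ∧
    x.c = Status.comp

/-- `x` is a prediction. -/
def Prediction (ws : List Words) (x : Item Feats Types) : Prop :=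
  x.i ≤ ws.length ∧ x.A.toPreAMRS = PreAMRS.empty ∧ x.j = x.i ∧ x.c = Status.act

/-- `x` comes from a rule with an empty body. -/
def EmptyRule (θ : Nodes → Types) (G : Grammar Feats Nodes) (ws : List Words)
    (x : Item Feats Types) : Prop :=
  ∃ ρ ∈ G.rules, (ρ.abs θ).len = 1 ∧
    x.i ≤ ws.length ∧ x.A.toPreAMRS = ρ.abs θ ∧ x.j = x.i ∧ x.c = Status.comp

/-- `x` comes from a category of an input word. -/
def Scanning (θ : Nodes → Types) (Cat : Words → Set (TFS Feats Nodes)) (ws : List Words)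
    (x : Item Feats Types) : Prop :=
  ∃ (i : ℕ) (hi : i < ws.length), ∃ A ∈ Cat ws[i],
    x.i = i ∧ x.A.toPreAMRS = A.abs θ ∧ x.j = i + 1 ∧ x.c = Status.comp

/-- The parsing operator `T_{G,w}`. -/
def parseStep (θ : Nodes → Types) (Cat : Words → Set (TFS Feats Nodes)) (G : Grammar Feats Nodes)
    (ws : List Words) (I : Set (Item Feats Types)) : Set (Item Feats Types) :=
  {x | DotMove θ G I x ∨ Completion θ G I x ∨ Prediction ws x ∨ EmptyRule θ G ws x ∨
    Scanning θ Cat ws x}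

/-- The `w`-computation `I_0 = ∅`, `I_{m+1} = T_{G,w}(I_m)`. -/
def computation (θ : Nodes → Types) (Cat : Words → Set (TFS Feats Nodes))
    (G : Grammar Feats Nodes) (ws : List Words) : ℕ → Set (Item Feats Types)
  | 0 => ∅
  | m + 1 => parseStep θ Cat G ws (computation θ Cat G ws m)

/-- The `w`-computation is successful: some `I_m` has a complete item `[0, A, n, Comp]` with
`len A = 1` and `A ⊔ Abs(A_s) ≠ ⊤`. -/
def Successful (θ : Nodes → Types) (Cat : Words → Set (TFS Feats Nodes))
    (G : Grammar Feats Nodes) (ws : List Words) : Prop :=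
  ∃ m, ∃ x ∈ computation θ Cat G ws m,
    x.i = 0 ∧ x.j = ws.length ∧ x.c = Status.comp ∧ x.A.len = 1 ∧
    ¬ (x.A.unifyAt 1 (G.start.abs θ)).Inconsistent

end Parsing

end TFSParsing

/-! The chart may contain less information than the derivation, never more, so success follows from
an invariant stated as containment. Call B recognized if the input splits into consecutive intervals
and, for each l, the chart has a complete item over the l-th interval that is part of the l-th
element of B (`Recognized`). Scanning gives this for every member of PT_w(1,n), and it passes upward
along subsumption.

The main step carries recognition backwards over A → B (`StrongDerives.recognized`). The body
elements of B are parts of the specialized rule R, because unifying them into R does not change it.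
Unification is the least coherent structure above its arguments (`MapsInto.unifyVia`), so everything
the parser builds from Abs(ρ) ⊑ R and these items remains part of R. As R is consistent, no
unification fails, and the resulting item is part of the head of R, hence of the j-th element of A.
The other elements of B contain no more than those of A: the head of R and the j-th element of A
agree exactly, so the replacement structure is already closed (`preReplace_coherent`) and its
closure adds nothing.

At the start of the derivation A' has length 1, which leaves one complete item spanning the input.
Its unification with Abs(A_s) lies below the consistent Abs(A_s) ⊔ A'.

Items must be AMRSs, so finiteness of the index also has to survive closure. It does because every
path of the closure is reentrant with an old path (`FinitelyIndexed.closure`). -/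

namespace TFSParsing

universe u v w z

namespace PreAMRS

variable {Feats : Type u} {Types : Type v} [CompleteLattice Types]

/-! ### Index maps between structures, coherent structures, and the closure `Ty ∘ Eq ∘ Cl` -/

/-- Renaming the indices of `A` along `g` maps the paths and reentrancies of `A` into those of `B`,
and the types of `B` are at least as specific. -/
structure MapsInto (g : ℕ → ℕ) (A B : PreAMRS Feats Types) : Prop where
  paths : ∀ p ∈ A.paths, (g p.1, p.2) ∈ B.paths
  rel : ∀ p q, A.rel p q → B.rel (g p.1, p.2) (g q.1, q.2)
  typ : ∀ p ∈ A.paths, A.typ p ≤ B.typ (g p.1, p.2)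

/-- The conditions on an AMRS except for the finiteness of the index. -/
structure Coherent (A : PreAMRS Feats Types) : Prop where
  prefixClosed : PrefixClosed A.paths
  extend : ∀ i i' π π' α, A.rel (i, π) (i', π') → (i, π ++ α) ∈ A.paths →
    A.rel (i, π ++ α) (i', π' ++ α)
  refl : ∀ p ∈ A.paths, A.rel p p
  symm : ∀ p q, A.rel p q → A.rel q p
  trans : ∀ p q s, A.rel p q → A.rel q s → A.rel p s
  typ_rel : ∀ p q, A.rel p q → A.typ p = A.typ q

/-- Finitely many paths represent all paths up to reentrancy. -/
def FinitelyIndexed (A : PreAMRS Feats Types) : Prop :=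
  ∃ F : Set (ℕ × List Feats), F.Finite ∧ ∀ p ∈ A.paths, ∃ q ∈ F, A.rel p q

/-- Outside the paths the type is the dummy value ⊥, so no membership hypothesis is needed. -/
theorem MapsInto.typ_le {g : ℕ → ℕ} {A B : PreAMRS Feats Types} (h : MapsInto g A B)
    (p : ℕ × List Feats) : A.typ p ≤ B.typ (g p.1, p.2) := by
  by_cases hp : p ∈ A.paths
  · exact h.typ p hp
  · rw [A.typ_outside p hp]
    exact bot_le

theorem MapsInto.comp {g h : ℕ → ℕ} {A B C : PreAMRS Feats Types} (hBC : MapsInto h B C)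
    (hAB : MapsInto g A B) : MapsInto (fun i => h (g i)) A C where
  paths := fun p hp => hBC.paths _ (hAB.paths p hp)
  rel := fun p q hpq => hBC.rel _ _ (hAB.rel p q hpq)
  typ := fun p hp => (hAB.typ p hp).trans (hBC.typ_le (g p.1, p.2))

/-- Only the indices 1, …, `A.len` occur in paths. On a structure of length 1 this lets `id` or a
shift be exchanged for a constant map. -/
theorem MapsInto.congr {g h : ℕ → ℕ} {A B : PreAMRS Feats Types} (hA : MapsInto g A B)
    (hgh : ∀ i, 1 ≤ i → i ≤ A.len → g i = h i) : MapsInto h A B where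
  paths := fun p hp => hgh p.1 (A.mem_ind p hp).1 (A.mem_ind p hp).2 ▸ hA.paths p hp
  rel := fun p q hpq => by
    have hp := A.mem_ind p (A.rel_mem p q hpq).1
    have hq := A.mem_ind q (A.rel_mem p q hpq).2
    rw [← hgh p.1 hp.1 hp.2, ← hgh q.1 hq.1 hq.2]
    exact hA.rel p q hpq
  typ := fun p hp => hgh p.1 (A.mem_ind p hp).1 (A.mem_ind p hp).2 ▸ hA.typ p hp

/-- Used in contrapositive form: whatever is part of a consistent structure is consistent, so
unifications that stay below it succeed. -/
theorem MapsInto.inconsistent {g : ℕ → ℕ} {A B : PreAMRS Feats Types} (h : MapsInto g A B)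
    (hA : A.Inconsistent) : B.Inconsistent := by
  obtain ⟨p, hp, ht⟩ := hA
  exact ⟨_, h.paths p hp, top_le_iff.1 (ht ▸ h.typ p hp)⟩

theorem Subsumes.mapsInto {A B : PreAMRS Feats Types} (h : A.Subsumes B) : MapsInto id A B :=
  ⟨h.2.1, h.2.2.1, h.2.2.2⟩

theorem Coherent.fusionClosed {A : PreAMRS Feats Types} (h : A.Coherent) :
    FusionClosed A.paths A.rel := by
  intro i i' π π' α α' h1 h2 hr
  have h3 := h.extend _ _ _ _ α hr h1
  have h4 := h.extend _ _ _ _ α' (h.symm _ _ hr) h2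
  exact ⟨(A.rel_mem _ _ h4).2, (A.rel_mem _ _ h3).2, h.symm _ _ h4, h.symm _ _ h3⟩

/-- The field `extend` is fusion with an empty suffix on the second side. -/
theorem coherent_of_AMRS (A : AMRS Feats Types) : A.toPreAMRS.Coherent where
  prefixClosed := A.prefixClosed
  extend := by
    intro i i' π π' α hr hp
    have hq : (i', π' ++ []) ∈ A.paths := by
      rw [List.append_nil]
      exact (A.rel_mem _ _ hr).2
    exact A.symm _ _ (A.fusionClosed i i' π π' α [] hp hq hr).2.2.2
  refl := A.refl
  symm := A.symm
  trans := A.trans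
  typ_rel := A.typ_rel

/-- One path is chosen from each class. The default `(0, [])` only serves the empty set, which is
not a class. -/
theorem finitelyIndexed_of_AMRS (A : AMRS Feats Types) : A.toPreAMRS.FinitelyIndexed := by
  classical
  refine ⟨(fun S : Set (ℕ × List Feats) => if h : S.Nonempty then h.some else (0, [])) ''
    _, A.finite_index.image _, fun p hp => ⟨_, ⟨_, ⟨p, hp, rfl⟩, rfl⟩, ?_⟩⟩
  have h : {q | A.rel p q}.Nonempty := ⟨p, A.refl p hp⟩
  dsimp only
  rw [dif_pos h]
  exact h.some_mem

/-- A coherent structure of finite index is an AMRS. -/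
def Coherent.toAMRS {A : PreAMRS Feats Types} (h : A.Coherent) (hF : A.FinitelyIndexed) :
    AMRS Feats Types where
  toPreAMRS := A
  prefixClosed := h.prefixClosed
  fusionClosed := h.fusionClosed
  refl := h.refl
  symm := h.symm
  trans := h.trans
  finite_index := by
    obtain ⟨F, hF, hcov⟩ := hF
    refine (hF.image fun p => {q | A.rel p q}).subset ?_
    rintro S ⟨p, hp, rfl⟩
    obtain ⟨q, hq, hpq⟩ := hcov p hp
    refine ⟨q, hq, Set.ext fun s => ⟨fun hs => h.trans _ _ _ hpq hs, fun hs => ?_⟩⟩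
    exact h.trans _ _ _ (h.symm _ _ hpq) hs
  typ_rel := h.typ_rel

/-! ### The closure -/

theorem cl_isClosedExtension (A : PreAMRS Feats Types) :
    A.IsClosedExtension A.cl.paths A.cl.rel := by
  refine ⟨fun p hp P r h => h.1 hp, fun p q hpq P r h => h.2.1 p q hpq,
    fun p hp => A.cl.mem_ind p hp, A.cl.rel_mem, ?_, ?_⟩
  · intro i π α hp P r h
    exact h.2.2.2.2.1 i π α (hp P r h)
  · intro i i' π π' α α' hp hq hr
    have key := fun P r (h : A.IsClosedExtension P r) =>
      h.2.2.2.2.2 i i' π π' α α' (hp P r h) (hq P r h) (hr P r h)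
    exact ⟨fun P r h => (key P r h).1, fun P r h => (key P r h).2.1,
      fun P r h => (key P r h).2.2.1, fun P r h => (key P r h).2.2.2⟩

/-- `Ty (Eq (Cl A))`. -/
def closure (A : PreAMRS Feats Types) : PreAMRS Feats Types :=
  A.cl.eqv.ty

/-- The generated equivalence is also reflexive outside the paths, so membership has to be carried
along the chain as an equivalence. With the empty suffix this says that a chain starting at a path
never leaves the paths. -/
theorem closure_extend (A : PreAMRS Feats Types) (p q : ℕ × List Feats)
    (h : Relation.EqvGen A.cl.rel p q) (α : List Feats) :
    ((p.1, p.2 ++ α) ∈ A.cl.paths ↔ (q.1, q.2 ++ α) ∈ A.cl.paths) ∧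
      ((p.1, p.2 ++ α) ∈ A.cl.paths →
        Relation.EqvGen A.cl.rel (p.1, p.2 ++ α) (q.1, q.2 ++ α)) := by
  induction h with
  | rel p q h =>
    have hF := A.cl_isClosedExtension.2.2.2.2.2
    have hm := A.cl.rel_mem p q h
    have h1 : (p.1, p.2 ++ α) ∈ A.cl.paths → (q.1, q.2 ++ α) ∈ A.cl.paths ∧
        A.cl.rel (q.1, q.2 ++ α) (p.1, p.2 ++ α) := fun hp =>
      (hF p.1 q.1 p.2 q.2 α [] hp (by simpa using hm.2) h).2.imp id And.right
    refine ⟨⟨fun hp => (h1 hp).1, fun hq => ?_⟩, fun hp => .symm _ _ (.rel _ _ (h1 hp).2)⟩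
    exact (hF p.1 q.1 p.2 q.2 [] α (by simpa using hm.1) hq h).1
  | refl p => exact ⟨Iff.rfl, fun _ => .refl _⟩
  | symm p q _ ih => exact ⟨ih.1.symm, fun hq => .symm _ _ (ih.2 (ih.1.2 hq))⟩
  | trans p q s _ _ ih1 ih2 =>
    exact ⟨ih1.1.trans ih2.1, fun hp => .trans _ _ _ (ih1.2 hp) (ih2.2 (ih1.1.1 hp))⟩

theorem closure_coherent (A : PreAMRS Feats Types) : A.closure.Coherent where
  prefixClosed := A.cl_isClosedExtension.2.2.2.2.1
  extend := by
    intro i i' π π' α hr hp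
    have h := A.closure_extend _ _ hr.2.2 α
    exact ⟨hp, h.1.1 hp, h.2 hp⟩
  refl := fun p hp => ⟨hp, hp, .refl _⟩
  symm := fun p q h => ⟨h.2.1, h.1, .symm _ _ h.2.2⟩
  trans := fun p q s h1 h2 => ⟨h1.1, h2.2.1, .trans _ _ _ h1.2.2 h2.2.2⟩
  typ_rel := by
    have key : ∀ p q, A.closure.rel p q → A.closure.typ p ≤ A.closure.typ q := by
      intro p q h
      refine iSup_le fun s => iSup_le fun hs => le_iSup_of_le s (le_iSup_of_le ?_ le_rfl)
      exact ⟨hs.1, h.2.1, .trans _ _ _ hs.2.2 h.2.2⟩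
    exact fun p q h => le_antisymm (key p q h) (key q p ⟨h.2.1, h.1, .symm _ _ h.2.2⟩)

theorem mapsInto_closure (A : PreAMRS Feats Types) : MapsInto id A A.closure where
  paths := fun p hp => A.cl_isClosedExtension.1 hp
  rel := fun p q h => by
    have h' := A.cl_isClosedExtension.2.1 p q h
    exact ⟨(A.cl.rel_mem _ _ h').1, (A.cl.rel_mem _ _ h').2, .rel _ _ h'⟩
  typ := fun p hp => by
    have hp' := A.cl_isClosedExtension.1 hp
    exact le_iSup_of_le p (le_iSup_of_le (show A.cl.eqv.rel p p from ⟨hp', hp', .refl _⟩) le_rfl)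

/-- The closure is the least coherent structure above a given one. -/
theorem MapsInto.closure {g : ℕ → ℕ} {A D : PreAMRS Feats Types} (h : MapsInto g A D)
    (hD : D.Coherent) : MapsInto g A.closure D := by
  -- The pullback of D along g, restricted to the indices of A, is a closed extension of A and
  -- therefore contains the least one.
  have hc : A.IsClosedExtension
      {p | (1 ≤ p.1 ∧ p.1 ≤ A.len) ∧ (g p.1, p.2) ∈ D.paths}
      (fun p q => ((1 ≤ p.1 ∧ p.1 ≤ A.len) ∧ (1 ≤ q.1 ∧ q.1 ≤ A.len)) ∧
        D.rel (g p.1, p.2) (g q.1, q.2)) := by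
    refine ⟨fun p hp => ⟨A.mem_ind p hp, h.paths p hp⟩, fun p q hpq =>
      ⟨⟨A.mem_ind p (A.rel_mem p q hpq).1, A.mem_ind q (A.rel_mem p q hpq).2⟩, h.rel p q hpq⟩,
      fun p hp => hp.1, fun p q hpq => ⟨⟨hpq.1.1, (D.rel_mem _ _ hpq.2).1⟩,
        ⟨hpq.1.2, (D.rel_mem _ _ hpq.2).2⟩⟩,
      fun i π α hp => ⟨hp.1, hD.prefixClosed _ _ _ hp.2⟩, ?_⟩
    intro i i' π π' α α' hp hq hr
    obtain ⟨h1, h2, h3, h4⟩ := hD.fusionClosed _ _ _ _ _ _ hp.2 hq.2 hr.2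
    exact ⟨⟨hp.1, h1⟩, ⟨hq.1, h2⟩, ⟨⟨hp.1, hq.1⟩, h3⟩, ⟨⟨hq.1, hp.1⟩, h4⟩⟩
  have hpaths : ∀ p ∈ A.closure.paths, (g p.1, p.2) ∈ D.paths := fun p hp => (hp _ _ hc).2
  have hgen : ∀ p q, Relation.EqvGen A.cl.rel p q → p ∈ A.cl.paths → q ∈ A.cl.paths →
      D.rel (g p.1, p.2) (g q.1, q.2) := by
    intro p q hpq
    induction hpq with
    | rel p q hr => exact fun _ _ => (hr _ _ hc).2
    | refl p => exact fun hp _ => hD.refl _ (hpaths p hp)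
    | symm p q _ ih => exact fun hq hp => hD.symm _ _ (ih hp hq)
    | trans p q s h1 _ ih1 ih2 =>
      intro hp hs
      have hq : q ∈ A.cl.paths := by
        have := (A.closure_extend p q h1 []).1.1
        simpa using this (by simpa using hp)
      exact hD.trans _ _ _ (ih1 hp hq) (ih2 hq hs)
  have hrel : ∀ p q, A.closure.rel p q → D.rel (g p.1, p.2) (g q.1, q.2) :=
    fun p q hpq => hgen p q hpq.2.2 hpq.1 hpq.2.1
  refine ⟨hpaths, hrel, fun p hp => iSup_le fun q => iSup_le fun hqp => ?_⟩
  -- Types in D are constant on classes, so the bound at q is also a bound at p; hence D bounds the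
  -- whole join.
  rw [← hD.typ_rel _ _ (hrel q p hqp)]
  exact h.typ_le q

/-- Closing creates no new classes: every path of the closure is related to a path of A, so
representatives for A still suffice. -/
theorem FinitelyIndexed.closure {A : PreAMRS Feats Types} (hA : A.FinitelyIndexed)
    (hP : PrefixClosed A.paths) : A.closure.FinitelyIndexed := by
  obtain ⟨F, hF, hcov⟩ := hA
  have hC := A.closure_coherent
  -- Asking the condition of all prefixes makes N prefix-closed by construction. N turns out to be a
  -- closed extension, so it contains every path of the closure.
  let N : Set (ℕ × List Feats) := {p | ∀ π α, p.2 = π ++ α → ∃ q ∈ A.paths,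
    A.closure.rel (p.1, π) q}
  have hN : ∀ p ∈ N, p ∈ A.cl.paths := by
    intro p hp
    obtain ⟨q, -, hq⟩ := hp p.2 [] (by simp)
    exact hq.1
  have hc : A.IsClosedExtension N (fun p q => p ∈ N ∧ q ∈ N ∧ A.cl.rel p q) := by
    have hsub : A.paths ⊆ N := by
      intro p hp π α hpα
      have hπ : (p.1, π) ∈ A.paths := hP p.1 π α (by rw [← hpα]; exact hp)
      exact ⟨_, hπ, hC.refl _ (A.mapsInto_closure.paths _ hπ)⟩
    have hpre : PrefixClosed N := by
      intro i π α hp π' α' h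
      refine hp π' (α' ++ α) ?_
      dsimp only at h ⊢
      rw [h, List.append_assoc]
    have hext : ∀ i i' π π' α, (i, π) ∈ N → (i', π' ++ α) ∈ N →
        A.closure.rel (i, π) (i', π') → (i, π ++ α) ∈ N := by
      intro i i' π π' α hp hq hr π₁ α₁ h
      dsimp only at h ⊢
      -- A prefix of π ++ α either passes beyond π, where it is related to the corresponding prefix
      -- of π' ++ α, or is a prefix of π itself.
      rcases List.append_eq_append_iff.1 h with ⟨a, rfl, h2⟩ | ⟨a, rfl, h2⟩
      · obtain ⟨q, hq1, hq2⟩ := hq (π' ++ a) α₁ (by dsimp only; rw [h2, List.append_assoc])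
        refine ⟨q, hq1, hC.trans _ _ _ (hC.symm _ _ ?_) hq2⟩
        exact hC.extend _ _ _ _ a (hC.symm _ _ hr) hq2.1
      · exact hp π₁ a rfl
    refine ⟨hsub, fun p q h => ⟨hsub (A.rel_mem _ _ h).1, hsub (A.rel_mem _ _ h).2,
      A.cl_isClosedExtension.2.1 _ _ h⟩, fun p hp => A.cl.mem_ind p (hN p hp),
      fun p q h => ⟨h.1, h.2.1⟩, hpre, ?_⟩
    rintro i i' π π' α α' hp hq ⟨hr1, hr2, hr⟩
    have hr' : A.closure.rel (i, π) (i', π') := ⟨hN _ hr1, hN _ hr2, .rel _ _ hr⟩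
    have h := A.cl_isClosedExtension.2.2.2.2.2 _ _ _ _ _ _ (hN _ hp) (hN _ hq) hr
    have h1 := hext _ _ _ _ _ hr1 hq hr'
    have h2 := hext _ _ _ _ _ hr2 hp (hC.symm _ _ hr')
    exact ⟨h1, h2, ⟨h1, hq, h.2.2.1⟩, ⟨h2, hp, h.2.2.2⟩⟩
  refine ⟨F, hF, fun p hp => ?_⟩
  obtain ⟨q, hq, hpq⟩ := hp _ _ hc p.2 [] (by simp)
  obtain ⟨s, hs, hqs⟩ := hcov q hq
  exact ⟨s, hs, hC.trans _ _ _ hpq (A.mapsInto_closure.rel _ _ hqs)⟩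

/-! ### Unification -/

theorem mapsInto_preUnify_left (f : ℕ → ℕ) (A : PreAMRS Feats Types) (J : Set ℕ)
    (B : PreAMRS Feats Types) : MapsInto id A (preUnify f A J B) where
  paths := fun _ hp => Or.inl hp
  rel := fun _ _ h => Or.inl h
  typ := fun _ _ => le_sup_left

theorem mapsInto_unifyVia_left (f : ℕ → ℕ) (A : PreAMRS Feats Types) (J : Set ℕ)
    (B : PreAMRS Feats Types) : MapsInto id A (unifyVia f A J B) :=
  (mapsInto_closure _).comp (mapsInto_preUnify_left f A J B)

/-- If `g` sends the indices of `B` to matched indices of `A`, then `B` is part of the result of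
its unification into `A`. -/
theorem mapsInto_unifyVia_right {f g : ℕ → ℕ} {A : PreAMRS Feats Types} {J : Set ℕ}
    {B : PreAMRS Feats Types} (hg : ∀ i, 1 ≤ i → i ≤ B.len →
      (1 ≤ g i ∧ g i ≤ A.len) ∧ g i ∈ J ∧ f (g i) = i) :
    MapsInto g B (unifyVia f A J B) := by
  refine (mapsInto_closure _).comp (h := id) ⟨fun p hp => ?_, fun p q h => ?_, fun p hp => ?_⟩
  · obtain ⟨h1, h2, h3⟩ := hg p.1 (B.mem_ind p hp).1 (B.mem_ind p hp).2
    refine Or.inr ⟨h1, h2, ?_⟩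
    dsimp only
    rw [h3]
    exact hp
  · obtain ⟨hp, hq⟩ := B.rel_mem p q h
    obtain ⟨h1, h2, h3⟩ := hg p.1 (B.mem_ind p hp).1 (B.mem_ind p hp).2
    obtain ⟨h1', h2', h3'⟩ := hg q.1 (B.mem_ind q hq).1 (B.mem_ind q hq).2
    refine Or.inr ⟨⟨h1, h2⟩, ⟨h1', h2'⟩, ?_⟩
    dsimp only
    rw [h3, h3']
    exact h
  · obtain ⟨h1, h2, h3⟩ := hg p.1 (B.mem_ind p hp).1 (B.mem_ind p hp).2
    refine le_sup_of_le_right (le_iSup_of_le ⟨h1, h2⟩ ?_)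
    dsimp only
    rw [h3]

/-- Unification yields the least coherent structure above its two arguments. -/
theorem MapsInto.unifyVia {f g h : ℕ → ℕ} {A B D : PreAMRS Feats Types} {J : Set ℕ}
    (hA : MapsInto g A D) (hB : MapsInto h B D) (hD : D.Coherent)
    (hf : ∀ i, 1 ≤ i → i ≤ A.len → i ∈ J → h (f i) = g i) :
    MapsInto g (unifyVia f A J B) D := by
  refine MapsInto.closure ⟨?_, ?_, ?_⟩ hD
  · rintro p (hp | ⟨⟨h1, h2⟩, h3, hp⟩)
    · exact hA.paths p hp
    · have := hB.paths _ hp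
      dsimp only at this
      rwa [hf _ h1 h2 h3] at this
  · rintro p q (hpq | ⟨⟨⟨h1, h2⟩, h3⟩, ⟨⟨h1', h2'⟩, h3'⟩, hpq⟩)
    · exact hA.rel p q hpq
    · have := hB.rel _ _ hpq
      dsimp only at this
      rwa [hf _ h1 h2 h3, hf _ h1' h2' h3'] at this
  · intro p _
    refine sup_le (hA.typ_le p) (iSup_le ?_)
    rintro ⟨⟨h1, h2⟩, h3⟩
    have := hB.typ_le (f p.1, p.2)
    dsimp only at this
    rwa [hf _ h1 h2 h3] at this

theorem unifyVia_coherent (f : ℕ → ℕ) (A : PreAMRS Feats Types) (J : Set ℕ)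
    (B : PreAMRS Feats Types) : (unifyVia f A J B).Coherent :=
  closure_coherent _

theorem unifyVia_finitelyIndexed (f : ℕ → ℕ) {A : PreAMRS Feats Types} (J : Set ℕ)
    {B : PreAMRS Feats Types} (hA : A.Coherent) (hB : B.Coherent) (hA' : A.FinitelyIndexed)
    (hB' : B.FinitelyIndexed) : (unifyVia f A J B).FinitelyIndexed := by
  classical
  refine FinitelyIndexed.closure ?_ ?_
  · obtain ⟨F, hF, hFc⟩ := hA'
    obtain ⟨F', hF', hFc'⟩ := hB'
    -- Paths of the result that the matching f sends into the class of b. One of them represents the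
    -- whole class, since B relates any two of them through b.
    let S : ℕ × List Feats → Set (ℕ × List Feats) := fun b =>
      {p | ((1 ≤ p.1 ∧ p.1 ≤ A.len) ∧ p.1 ∈ J) ∧ B.rel (f p.1, p.2) b}
    refine ⟨F ∪ (fun b => if h : (S b).Nonempty then h.some else (0, [])) '' F',
      hF.union (hF'.image _), ?_⟩
    rintro p (hp | ⟨h1, h2, hp⟩)
    · obtain ⟨q, hq, hpq⟩ := hFc p hp
      exact ⟨q, Or.inl hq, Or.inl hpq⟩
    · obtain ⟨b, hb, hpb⟩ := hFc' _ hp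
      refine ⟨_, Or.inr ⟨b, hb, rfl⟩, Or.inr ?_⟩
      have hS : (S b).Nonempty := ⟨p, ⟨h1, h2⟩, hpb⟩
      dsimp only
      rw [dif_pos hS]
      exact ⟨⟨h1, h2⟩, hS.some_mem.1, hB.trans _ _ _ hpb (hB.symm _ _ hS.some_mem.2)⟩
  · rintro i π α (hp | ⟨h1, h2, hp⟩)
    · exact Or.inl (hA.prefixClosed _ _ _ hp)
    · exact Or.inr ⟨h1, h2, hB.prefixClosed _ _ _ hp⟩

/-! ### Sub-structures and the empty structure -/

theorem mapsInto_sub (A : PreAMRS Feats Types) (j k : ℕ) :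
    MapsInto (fun i => i + (j - 1)) (A.sub j k) A where
  paths := fun _ hp => hp.2
  rel := fun _ _ h => h.2.2
  typ := fun _ _ => iSup_le fun _ => le_rfl

/-- A structure whose image in `A` lies in the indices `j, …, k` is part of `A^{j..k}`. -/
theorem MapsInto.sub {g h : ℕ → ℕ} {X A : PreAMRS Feats Types} {j k : ℕ} (hX : MapsInto g X A)
    (hg : ∀ i, 1 ≤ i → i ≤ X.len → g i ≤ A.len →
      (1 ≤ h i ∧ h i ≤ min k A.len - (j - 1)) ∧ h i + (j - 1) = g i) :
    MapsInto h X (A.sub j k) := by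
  have key : ∀ p ∈ X.paths, (1 ≤ h p.1 ∧ h p.1 ≤ min k A.len - (j - 1)) ∧
      h p.1 + (j - 1) = g p.1 := fun p hp =>
    hg p.1 (X.mem_ind p hp).1 (X.mem_ind p hp).2 (A.mem_ind _ (hX.paths p hp)).2
  refine ⟨fun p hp => ⟨(key p hp).1, ?_⟩, fun p q hpq => ?_, fun p hp =>
    le_iSup_of_le (key p hp).1 ?_⟩
  · dsimp only
    rw [(key p hp).2]
    exact hX.paths p hp
  · obtain ⟨hp, hq⟩ := X.rel_mem p q hpq
    refine ⟨(key p hp).1, (key q hq).1, ?_⟩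
    dsimp only
    rw [(key p hp).2, (key q hq).2]
    exact hX.rel p q hpq
  · dsimp only
    rw [(key p hp).2]
    exact hX.typ p hp

theorem Coherent.sub {A : PreAMRS Feats Types} (h : A.Coherent) (j k : ℕ) :
    (A.sub j k).Coherent where
  prefixClosed := fun _ _ _ hp => ⟨hp.1, h.prefixClosed _ _ _ hp.2⟩
  extend := fun _ _ _ _ _ hr hp => ⟨hr.1, hr.2.1, h.extend _ _ _ _ _ hr.2.2 hp.2⟩
  refl := fun _ hp => ⟨hp.1, hp.1, h.refl _ hp.2⟩
  symm := fun _ _ hr => ⟨hr.2.1, hr.1, h.symm _ _ hr.2.2⟩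
  trans := fun _ _ _ h1 h2 => ⟨h1.1, h2.2.1, h.trans _ _ _ h1.2.2 h2.2.2⟩
  typ_rel := by
    intro p q hr
    show (⨆ _, _) = (⨆ _, _)
    rw [iSup_pos hr.1, iSup_pos hr.2.1]
    exact h.typ_rel _ _ hr.2.2

theorem FinitelyIndexed.sub {A : PreAMRS Feats Types} (hA : A.FinitelyIndexed) (h : A.Coherent)
    (j k : ℕ) : (A.sub j k).FinitelyIndexed := by
  classical
  obtain ⟨F, hF, hcov⟩ := hA
  let S : ℕ × List Feats → Set (ℕ × List Feats) := fun b =>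
    {p | p ∈ (A.sub j k).paths ∧ A.rel (p.1 + (j - 1), p.2) b}
  refine ⟨(fun b => if h : (S b).Nonempty then h.some else (0, [])) '' F, hF.image _, ?_⟩
  intro p hp
  obtain ⟨b, hb, hpb⟩ := hcov _ hp.2
  refine ⟨_, ⟨b, hb, rfl⟩, ?_⟩
  have hS : (S b).Nonempty := ⟨p, hp, hpb⟩
  dsimp only
  rw [dif_pos hS]
  exact ⟨hp.1, hS.some_mem.1.1, h.trans _ _ _ hpb (h.symm _ _ hS.some_mem.2)⟩

theorem empty_coherent : (empty : PreAMRS Feats Types).Coherent where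
  prefixClosed := fun _ _ _ h => h.elim
  extend := fun _ _ _ _ _ h => h.elim
  refl := fun _ h => h.elim
  symm := fun _ _ h => h.elim
  trans := fun _ _ _ h => h.elim
  typ_rel := fun _ _ h => h.elim

theorem empty_finitelyIndexed : (empty : PreAMRS Feats Types).FinitelyIndexed :=
  ⟨∅, Set.finite_empty, fun _ h => h.elim⟩

theorem mapsInto_empty (g : ℕ → ℕ) (A : PreAMRS Feats Types) : MapsInto g empty A :=
  ⟨fun _ h => h.elim, fun _ _ h => h.elim, fun _ h => h.elim⟩

/-! ### Concatenation -/

theorem mapsInto_concat_left (A B : PreAMRS Feats Types) : MapsInto id A (A.concat B) where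
  paths := fun _ hp => Or.inl hp
  rel := fun _ _ h => Or.inl h
  typ := fun p hp => (if_pos (A.mem_ind p hp).2).ge

theorem mapsInto_concat_right (A B : PreAMRS Feats Types) :
    MapsInto (fun i => i + A.len) B (A.concat B) where
  paths := fun p hp => Or.inr ⟨by have := B.mem_ind p hp; dsimp only; omega, by simpa using hp⟩
  rel := fun p q h => by
    have hp := B.mem_ind p (B.rel_mem p q h).1
    have hq := B.mem_ind q (B.rel_mem p q h).2
    exact Or.inr ⟨by dsimp only; omega, by dsimp only; omega, by simpa using h⟩
  typ := fun p hp => by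
    have := B.mem_ind p hp
    have h : ¬ p.1 + A.len ≤ A.len := by omega
    simp [concat, h]

/-! ### Replacement of an element by the body of a rule -/

/-- If the replaced element and the head of the rule coincide, then the result of the replacement
is already closed. -/
theorem preReplace_coherent {A R : PreAMRS Feats Types} {j : ℕ} (hj : 1 ≤ j ∧ j ≤ A.len)
    (hR : 1 ≤ R.len) (hA : A.Coherent) (hRc : R.Coherent)
    (hpaths : ∀ π, (j, π) ∈ A.paths ↔ (R.len, π) ∈ R.paths)
    (hrel : ∀ π π', A.rel (j, π) (j, π') ↔ R.rel (R.len, π) (R.len, π'))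
    (htyp : ∀ π, A.typ (j, π) = R.typ (R.len, π)) :
    (preReplace A j R hj hR).Coherent where
  prefixClosed := by
    intro i π α h
    simp only [preReplace, Set.mem_ofPred_eq] at h ⊢
    generalize origin j R.len i = o at h ⊢
    cases o
    · exact hA.prefixClosed _ _ _ h
    · exact hRc.prefixClosed _ _ _ h
  extend := by
    intro i i' π π' α h hp
    simp only [preReplace, Set.mem_ofPred_eq] at h hp ⊢
    generalize origin j R.len i = o at h hp ⊢
    generalize origin j R.len i' = o' at h ⊢
    cases o <;> cases o' <;> dsimp only at h hp ⊢
    · exact hA.extend _ _ _ _ _ h hp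
    · obtain ⟨π₁, h1, h2⟩ := h
      have h3 := hA.extend _ _ _ _ α h1 hp
      exact ⟨π₁ ++ α, h3, hRc.extend _ _ _ _ α h2 ((hpaths _).1 (A.rel_mem _ _ h3).2)⟩
    · obtain ⟨π₁, h1, h2⟩ := h
      have h3 := hRc.extend _ _ _ _ α h1 hp
      exact ⟨π₁ ++ α, h3, hA.extend _ _ _ _ α h2 ((hpaths _).2 (R.rel_mem _ _ h3).2)⟩
    · exact hRc.extend _ _ _ _ _ h hp
  refl := by
    rintro ⟨i, π⟩ hp
    simp only [preReplace, Set.mem_ofPred_eq] at hp ⊢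
    generalize origin j R.len i = o at hp ⊢
    cases o
    · exact hA.refl _ hp
    · exact hRc.refl _ hp
  symm := by
    rintro ⟨i, π⟩ ⟨i', π'⟩ h
    simp only [preReplace] at h ⊢
    generalize origin j R.len i = o at h ⊢
    generalize origin j R.len i' = o' at h ⊢
    cases o <;> cases o' <;> dsimp only at h ⊢
    · exact hA.symm _ _ h
    · obtain ⟨π₁, h1, h2⟩ := h
      exact ⟨π₁, hRc.symm _ _ h2, hA.symm _ _ h1⟩
    · obtain ⟨π₁, h1, h2⟩ := h
      exact ⟨π₁, hA.symm _ _ h2, hRc.symm _ _ h1⟩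
    · exact hRc.symm _ _ h
  trans := by
    rintro ⟨i, π⟩ ⟨i', π'⟩ ⟨i'', π''⟩ h h'
    simp only [preReplace] at h h' ⊢
    generalize origin j R.len i = o at h ⊢
    generalize origin j R.len i' = o' at h h'
    generalize origin j R.len i'' = o'' at h' ⊢
    cases o <;> cases o' <;> cases o'' <;> dsimp only at h h' ⊢
    · exact hA.trans _ _ _ h h'
    · obtain ⟨π₁, h1, h2⟩ := h'
      exact ⟨π₁, hA.trans _ _ _ h h1, h2⟩
    -- A chain leaving A through the head at π₁ and returning at π₂: R relates these two paths of
    -- its head, so A relates them in its j-th element.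
    · obtain ⟨π₁, h1, h2⟩ := h
      obtain ⟨π₂, h3, h4⟩ := h'
      exact hA.trans _ _ _ h1 (hA.trans _ _ _ ((hrel _ _).2 (hRc.trans _ _ _ h2 h3)) h4)
    · obtain ⟨π₁, h1, h2⟩ := h
      exact ⟨π₁, h1, hRc.trans _ _ _ h2 h'⟩
    · obtain ⟨π₁, h1, h2⟩ := h
      exact ⟨π₁, h1, hA.trans _ _ _ h2 h'⟩
    · obtain ⟨π₁, h1, h2⟩ := h
      obtain ⟨π₂, h3, h4⟩ := h'
      exact hRc.trans _ _ _ h1 (hRc.trans _ _ _ ((hrel _ _).1 (hA.trans _ _ _ h2 h3)) h4)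
    · obtain ⟨π₁, h1, h2⟩ := h'
      exact ⟨π₁, hRc.trans _ _ _ h h1, h2⟩
    · exact hRc.trans _ _ _ h h'
  typ_rel := by
    rintro ⟨i, π⟩ ⟨i', π'⟩ h
    simp only [preReplace] at h ⊢
    generalize origin j R.len i = o at h ⊢
    generalize origin j R.len i' = o' at h ⊢
    cases o <;> cases o' <;> dsimp only at h ⊢
    · exact hA.typ_rel _ _ h
    · obtain ⟨π₁, h1, h2⟩ := h
      rw [hA.typ_rel _ _ h1, htyp, hRc.typ_rel _ _ h2]
    · obtain ⟨π₁, h1, h2⟩ := h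
      rw [hRc.typ_rel _ _ h1, ← htyp, hA.typ_rel _ _ h2]
    · exact hRc.typ_rel _ _ h

end PreAMRS

/-! ### Abstractions of concrete structures -/

section Abs

variable {Feats : Type u} {Types : Type v} [CompleteLattice Types] {Nodes : Type w}

theorem run_append (δ : Nodes → Feats → Option Nodes) (q : Nodes) (π α : List Feats) :
    run δ q (π ++ α) = (run δ q π).bind fun q' => run δ q' α := by
  induction π generalizing q with
  | nil => rfl
  | cons f π ih =>
    simp only [List.cons_append, run, Option.bind_assoc, ih]

theorem MRS.run_mem (σ : MRS Feats Nodes) {q q' : Nodes} (π : List Feats) (hq : q ∈ σ.Q)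
    (h : run σ.δ q π = some q') : q' ∈ σ.Q := by
  induction π generalizing q with
  | nil => exact Option.some.inj h ▸ hq
  | cons f π ih =>
    obtain ⟨q₁, h1, h2⟩ := Option.bind_eq_some_iff.1 h
    exact ih (σ.δ_mem _ _ _ h1).2 h2

theorem MRS.node_append (σ : MRS Feats Nodes) (i : ℕ) (π α : List Feats) :
    σ.node (i, π ++ α) = (σ.node (i, π)).bind fun q => run σ.δ q α := by
  unfold MRS.node
  dsimp only
  split_ifs
  · rfl
  · simp only [run_append, Option.bind_assoc]

theorem MRS.node_mem (σ : MRS Feats Nodes) {p : ℕ × List Feats} {q : Nodes}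
    (h : σ.node p = some q) : q ∈ σ.Q := by
  unfold MRS.node at h
  split_ifs at h
  obtain ⟨r, h1, h2⟩ := Option.bind_eq_some_iff.1 h
  exact σ.run_mem _ (σ.roots_mem r (List.mem_of_getElem? h1)) h2

theorem MRS.abs_coherent (θ : Nodes → Types) (σ : MRS Feats Nodes) :
    (σ.abs θ : PreAMRS Feats Types).Coherent where
  prefixClosed := by
    rintro i π α ⟨q, hq⟩
    rw [σ.node_append] at hq
    obtain ⟨q', h, -⟩ := Option.bind_eq_some_iff.1 hq
    exact ⟨q', h⟩
  extend := by
    rintro i i' π π' α ⟨q, h1, h2⟩ ⟨q', h⟩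
    refine ⟨q', h, ?_⟩
    rw [σ.node_append, h1] at h
    rw [σ.node_append, h2]
    exact h
  refl := fun p ⟨q, hq⟩ => ⟨q, hq, hq⟩
  symm := fun p p' ⟨q, h, h'⟩ => ⟨q, h', h⟩
  trans := by
    rintro p p' p'' ⟨q, h1, h2⟩ ⟨q', h3, h4⟩
    rw [h2] at h3
    exact ⟨q, h1, h3 ▸ h4⟩
  typ_rel := by
    rintro p p' ⟨q, h1, h2⟩
    simp only [MRS.abs, h1, h2]

theorem MRS.abs_finitelyIndexed (θ : Nodes → Types) (σ : MRS Feats Nodes) :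
    (σ.abs θ : PreAMRS Feats Types).FinitelyIndexed := by
  classical
  refine ⟨(fun q => if h : ∃ p, σ.node p = some q then h.choose else (0, [])) '' σ.Q,
    σ.finite.image _, ?_⟩
  rintro p ⟨q, hq⟩
  refine ⟨_, ⟨q, σ.node_mem hq, rfl⟩, q, hq, ?_⟩
  have h : ∃ p, σ.node p = some q := ⟨p, hq⟩
  dsimp only
  rw [dif_pos h]
  exact h.choose_spec

/-- The abstraction of a multi-rooted structure as an AMRS. -/
def MRS.absAMRS (θ : Nodes → Types) (σ : MRS Feats Nodes) : AMRS Feats Types :=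
  (σ.abs_coherent θ).toAMRS (σ.abs_finitelyIndexed θ)

end Abs

/-! ### Agreement of a replaced element with the head of a rule -/

namespace PreAMRS

variable {Feats : Type u} {Types : Type v} [CompleteLattice Types]

theorem MapsInto.refl (A : PreAMRS Feats Types) : MapsInto id A A :=
  ⟨fun _ h => h, fun _ _ h => h, fun _ _ => le_rfl⟩

theorem sub_self_len (A : PreAMRS Feats Types) {j : ℕ} (hj : 1 ≤ j ∧ j ≤ A.len) :
    (A.sub j j).len = 1 := by
  show min j A.len - (j - 1) = 1
  omega

/-- The `j`-th element of `A` is part of any structure that contains it through unification. -/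
theorem mapsInto_of_eq_unifyAt {A B : PreAMRS Feats Types} {i j : ℕ} (hi : 1 ≤ i ∧ i ≤ A.len)
    (hj : 1 ≤ j ∧ j ≤ B.len) (h : A = A.unifyAt i (B.sub j j)) :
    MapsInto (fun _ => i) (B.sub j j) A := by
  have key : MapsInto (fun _ => i) (B.sub j j) (A.unifyAt i (B.sub j j)) := by
    refine mapsInto_unifyVia_right fun k h1 h2 => ⟨hi, rfl, ?_⟩
    rw [sub_self_len B hj] at h2
    omega
  rwa [← h] at key

/-- Index 1 of the sub-structure is index j of B. Applied in both directions, this lemma and the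
next two give the exact agreement required by `preReplace_coherent`. -/
theorem paths_of_mapsInto_sub {A B : PreAMRS Feats Types} {i j : ℕ} (hj : 1 ≤ j ∧ j ≤ B.len)
    (h : MapsInto (fun _ => i) (B.sub j j) A) {π : List Feats} (hπ : (j, π) ∈ B.paths) :
    (i, π) ∈ A.paths := by
  have e : 1 + (j - 1) = j := by omega
  refine h.paths (1, π) ⟨by dsimp only; omega, ?_⟩
  dsimp only
  rwa [e]

theorem rel_of_mapsInto_sub {A B : PreAMRS Feats Types} {i j : ℕ} (hj : 1 ≤ j ∧ j ≤ B.len)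
    (h : MapsInto (fun _ => i) (B.sub j j) A) {π π' : List Feats}
    (hr : B.rel (j, π) (j, π')) : A.rel (i, π) (i, π') := by
  have e : 1 + (j - 1) = j := by omega
  refine h.rel (1, π) (1, π') ⟨by dsimp only; omega, by dsimp only; omega, ?_⟩
  dsimp only
  rwa [e]

theorem typ_of_mapsInto_sub {A B : PreAMRS Feats Types} {i j : ℕ} (hj : 1 ≤ j ∧ j ≤ B.len)
    (h : MapsInto (fun _ => i) (B.sub j j) A) (π : List Feats) :
    B.typ (j, π) ≤ A.typ (i, π) := by
  have e : 1 + (j - 1) = j := by omega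
  refine le_trans ?_ (h.typ_le (1, π))
  refine le_iSup_of_le (by dsimp only; omega) ?_
  dsimp only
  rw [e]

/-- A part of the replacement structure that comes from the rest of `A` is a part of `A`. -/
theorem MapsInto.of_preReplace {X A R : PreAMRS Feats Types} {j l i : ℕ}
    {hj : 1 ≤ j ∧ j ≤ A.len} {hR : 1 ≤ R.len}
    (h : MapsInto (fun _ => l) X (preReplace A j R hj hR)) (ho : origin j R.len l = Sum.inl i) :
    MapsInto (fun _ => i) X A where
  paths := fun p hp => by simpa [preReplace, ho] using h.paths p hp
  rel := fun p q hpq => by simpa [preReplace, ho] using h.rel p q hpq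
  typ := fun p hp => by simpa [preReplace, ho] using h.typ p hp

end PreAMRS

open PreAMRS

section Parsing

variable {Feats : Type u} {Types : Type v} [CompleteLattice Types] {Nodes : Type w}
  {Words : Type z} {θ : Nodes → Types} {Cat : Words → Set (TFS Feats Nodes)}
  {G : Grammar Feats Nodes} {ws : List Words}

/-! ### The chart -/

theorem parseStep_mono {I I' : Set (Item Feats Types)} (h : I ⊆ I') :
    parseStep θ Cat G ws I ⊆ parseStep θ Cat G ws I' := by
  rintro x (⟨ρ, hρ, k, h1, h2, α, hα, h3, h4, β, hβ, h5⟩ | ⟨ρ, hρ, h1, α, hα, h2⟩ | hx)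
  · exact Or.inl ⟨ρ, hρ, k, h1, h2, α, h hα, h3, h4, β, h hβ, h5⟩
  · exact Or.inr (Or.inl ⟨ρ, hρ, h1, α, h hα, h2⟩)
  · exact Or.inr (Or.inr hx)

theorem computation_mono :
    Monotone (computation θ Cat G ws : ℕ → Set (Item Feats Types)) := by
  refine monotone_nat_of_le_succ fun m => ?_
  induction m with
  | zero => exact Set.empty_subset _
  | succ m ih => exact parseStep_mono ih

variable (θ Cat G ws) in
/-- All items that are eventually computed. -/
def chart : Set (Item Feats Types) :=
  ⋃ m, computation θ Cat G ws m

/-- A finite set of premises already lies in a single stage, because the stages increase. The chart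
is thus closed under every rule application with finitely many premises. -/
theorem parseStep_chart {x : Item Feats Types} {F : Set (Item Feats Types)} (hF : F.Finite)
    (hFc : F ⊆ chart θ Cat G ws) (hx : x ∈ parseStep θ Cat G ws F) : x ∈ chart θ Cat G ws := by
  have hdir : Directed (· ⊆ ·) (computation θ Cat G ws : ℕ → Set (Item Feats Types)) :=
    computation_mono.directed_le
  obtain ⟨m, hm⟩ := hdir.exists_mem_subset_of_finset_subset_biUnion
    (s := hF.toFinset) (by rwa [hF.coe_toFinset])
  rw [hF.coe_toFinset] at hm
  exact Set.mem_iUnion.2 ⟨m + 1, parseStep_mono hm hx⟩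

/-- The chart has a complete item of length `1` from `a` to `b` that is part of `B` at `l`. -/
def HasComplete (θ : Nodes → Types) (Cat : Words → Set (TFS Feats Nodes))
    (G : Grammar Feats Nodes) (ws : List Words) (a b : ℕ) (B : PreAMRS Feats Types)
    (l : ℕ) : Prop :=
  ∃ x ∈ chart θ Cat G ws, x.i = a ∧ x.j = b ∧ x.c = Status.comp ∧ x.A.len = 1 ∧
    MapsInto (fun _ => l) x.A.toPreAMRS B

/-- The chart has consecutive complete items that span the input and are parts of the successive
elements of `B`. -/
def Recognized (θ : Nodes → Types) (Cat : Words → Set (TFS Feats Nodes))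
    (G : Grammar Feats Nodes) (ws : List Words) (B : PreAMRS Feats Types) : Prop :=
  ∃ t : ℕ → ℕ, t 0 = 0 ∧ t B.len = ws.length ∧ (∀ l ≤ B.len, t l ≤ ws.length) ∧
    ∀ l, 1 ≤ l → l ≤ B.len → HasComplete θ Cat G ws (t (l - 1)) (t l) B l

/-! ### Recognition of the body of a rule -/

/-- Active items cover every initial part of the body of a rule. -/
theorem exists_active {ρ : MRS Feats Nodes} (hρ : ρ ∈ G.rules) {R : AMRS Feats Types}
    (hρR : (ρ.abs θ).Subsumes R.toPreAMRS) (hR : ¬ R.Inconsistent) (hlen : 1 < R.len)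
    {s : ℕ → ℕ} (hs : s 0 ≤ ws.length)
    (hbody : ∀ l, 1 ≤ l → l ≤ R.len - 1 →
      HasComplete θ Cat G ws (s (l - 1)) (s l) R.toPreAMRS l)
    (k : ℕ) (hk : k ≤ R.len - 1) :
    ∃ x ∈ chart θ Cat G ws, x.i = s 0 ∧ x.j = s k ∧ x.c = Status.act ∧ x.A.len = k ∧
      MapsInto id x.A.toPreAMRS R.toPreAMRS := by
  have hl : (ρ.abs θ : PreAMRS Feats Types).len = R.len := hρR.1
  have hRc := coherent_of_AMRS R
  induction k with
  | zero =>
    refine ⟨⟨s 0, empty_coherent.toAMRS empty_finitelyIndexed, s 0, .act, le_rfl⟩,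
      parseStep_chart Set.finite_empty (Set.empty_subset _)
        (Or.inr (Or.inr (Or.inl ⟨hs, rfl, rfl, rfl⟩))),
      rfl, rfl, rfl, rfl, mapsInto_empty _ _⟩
  | succ k ih =>
    obtain ⟨α, hα, hαi, hαj, hαc, hαl, hαR⟩ := ih (by omega)
    obtain ⟨β, hβ, hβi, hβj, hβc, hβl, hβR⟩ := hbody (k + 1) (by omega) hk
    rw [Nat.add_sub_cancel] at hβi
    let B : PreAMRS Feats Types := (ρ.abs θ).unify (Set.Icc 1 k) α.A.toPreAMRS
    let C : PreAMRS Feats Types := B.unifyAt (k + 1) β.A.toPreAMRS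
    -- Abs(ρ) and both items are parts of the coherent R, so the least structures above them are
    -- too. Consistency of R then excludes failure.
    have hBR : MapsInto id B R.toPreAMRS := hρR.mapsInto.unifyVia hαR hRc fun _ _ _ _ => rfl
    have hCR : MapsInto id C R.toPreAMRS := hBR.unifyVia hβR hRc fun _ _ _ h => h.symm
    have hBc : B.Coherent := unifyVia_coherent _ _ _ _
    have hCc : C.Coherent := unifyVia_coherent _ _ _ _
    have hBf : B.FinitelyIndexed := unifyVia_finitelyIndexed _ _ (ρ.abs_coherent θ)
      (coherent_of_AMRS _) (ρ.abs_finitelyIndexed θ) (finitelyIndexed_of_AMRS _)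
    have hCf : C.FinitelyIndexed := unifyVia_finitelyIndexed _ _ hBc
      (coherent_of_AMRS _) hBf (finitelyIndexed_of_AMRS _)
    have hCl : C.len = R.len := hl
    refine ⟨⟨α.i, (hCc.sub 1 (k + 1)).toAMRS (hCf.sub hCc _ _), β.j, .act, ?_⟩,
      parseStep_chart (F := {α, β}) (Set.toFinite _) ?_ (Or.inl ⟨ρ, hρ, k, hl ▸ hlen,
        by rw [hl]; omega, α, Or.inl rfl, hαc, hαl, β, Or.inr rfl, hβc, hβl,
        hαj.trans hβi.symm, B, C, rfl, fun h => hR (hBR.inconsistent h), rfl,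
        fun h => hR (hCR.inconsistent h), rfl, rfl, rfl, rfl⟩),
      hαi, hβj, rfl, ?_, ?_⟩
    · exact α.le.trans ((hαj.trans hβi.symm).le.trans β.le)
    · rintro x (rfl | rfl)
      · exact hα
      · exact hβ
    · show min (k + 1) C.len - (1 - 1) = k + 1
      omega
    · exact (hCR.comp (mapsInto_sub C 1 (k + 1))).congr fun _ _ _ => rfl

/-- If the elements of the body of a rule are recognized, then so is the head. -/
theorem hasComplete_head {ρ : MRS Feats Nodes} (hρ : ρ ∈ G.rules) {R : AMRS Feats Types}
    (hρR : (ρ.abs θ).Subsumes R.toPreAMRS) (hR : ¬ R.Inconsistent) (hlen : 1 ≤ R.len)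
    {s : ℕ → ℕ} (hs : s 0 ≤ ws.length)
    (hbody : ∀ l, 1 ≤ l → l ≤ R.len - 1 →
      HasComplete θ Cat G ws (s (l - 1)) (s l) R.toPreAMRS l) :
    HasComplete θ Cat G ws (s 0) (s (R.len - 1)) R.toPreAMRS R.len := by
  have hl : (ρ.abs θ : PreAMRS Feats Types).len = R.len := hρR.1
  rcases hlen.eq_or_lt with h1 | h1
  -- Empty body: the rule is its own head, and it is recognized over an empty interval.
  · rw [← h1] at hl ⊢
    refine ⟨⟨s 0, (ρ.abs_coherent θ).toAMRS (ρ.abs_finitelyIndexed θ), s 0, .comp, le_rfl⟩,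
      parseStep_chart Set.finite_empty (Set.empty_subset _)
        (Or.inr (Or.inr (Or.inr (Or.inl ⟨ρ, hρ, hl, hs, rfl, rfl, rfl⟩)))),
      rfl, rfl, rfl, hl, hρR.mapsInto.congr fun i h2 h3 => ?_⟩
    show i = 1
    omega
  · obtain ⟨α, hα, hαi, hαj, hαc, hαl, hαR⟩ := exists_active hρ hρR hR h1 hs hbody _ le_rfl
    let C : PreAMRS Feats Types :=
      (ρ.abs θ).unify (Set.Icc 1 ((ρ.abs θ : PreAMRS Feats Types).len - 1)) α.A.toPreAMRS
    have hCR : MapsInto id C R.toPreAMRS :=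
      hρR.mapsInto.unifyVia hαR (coherent_of_AMRS R) fun _ _ _ _ => rfl
    have hCc : C.Coherent := unifyVia_coherent _ _ _ _
    have hCf : C.FinitelyIndexed := unifyVia_finitelyIndexed _ _ (ρ.abs_coherent θ)
      (coherent_of_AMRS _) (ρ.abs_finitelyIndexed θ) (finitelyIndexed_of_AMRS _)
    have hCl : C.len = R.len := hl
    have hlen1 : (C.sub (ρ.abs θ : PreAMRS Feats Types).len
        (ρ.abs θ : PreAMRS Feats Types).len).len = 1 :=
      sub_self_len C ⟨by omega, by omega⟩
    refine ⟨⟨α.i, (hCc.sub _ _).toAMRS (hCf.sub hCc _ _), α.j, .comp, α.le⟩,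
      parseStep_chart (Set.finite_singleton α) (Set.singleton_subset_iff.2 hα)
        (Or.inr (Or.inl ⟨ρ, hρ, by omega, α, rfl, hαc, by omega, C, rfl,
          fun h => hR (hCR.inconsistent h), rfl, rfl, rfl, rfl⟩)),
      hαi, hαj, rfl, hlen1, (hCR.comp (mapsInto_sub C _ _)).congr fun i h2 h3 => ?_⟩
    have h4 : i ≤ 1 := hlen1 ▸ h3
    show i + ((ρ.abs θ : PreAMRS Feats Types).len - 1) = R.len
    omega

theorem HasComplete.mono {a b l l' : ℕ} {B B' : PreAMRS Feats Types}
    (h : HasComplete θ Cat G ws a b B l)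
    (hB : ∀ X : PreAMRS Feats Types, X.len = 1 → MapsInto (fun _ => l) X B →
      MapsInto (fun _ => l') X B') : HasComplete θ Cat G ws a b B' l' := by
  obtain ⟨x, hx, h1, h2, h3, h4, h5⟩ := h
  exact ⟨x, hx, h1, h2, h3, h4, hB _ h4 h5⟩

/-! ### Derivations preserve recognition backwards -/

/-- The items over the body of R merge into one item for the j-th element of A; all other items are
kept. -/
theorem StrongDerives.recognized {A B : AMRS Feats Types} (h : StrongDerives θ G A B)
    (hB : Recognized θ Cat G ws B.toPreAMRS) : Recognized θ Cat G ws A.toPreAMRS := by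
  obtain ⟨ρ, hρ, R, hρR, j, hj, hR, ⟨-, h1⟩, ⟨hc, h2⟩, -, ⟨-, h4⟩, h5⟩ := h
  obtain ⟨t, t0, tlen, tle, hX⟩ := hB
  have hRcons : ¬ R.Inconsistent := by rwa [← h2] at hc
  have hBlen : B.len = A.len + R.len - 2 := congrArg PreAMRS.len h5
  have hRr : 1 ≤ R.len ∧ R.len ≤ R.len := ⟨hR, le_rfl⟩
  have hRA := mapsInto_of_eq_unifyAt hj hRr h1
  have hAR := mapsInto_of_eq_unifyAt hRr hj h2
  have hrep : (preReplace A.toPreAMRS j R.toPreAMRS hj hR).Coherent :=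
    preReplace_coherent hj hR (coherent_of_AMRS A) (coherent_of_AMRS R)
      (fun π => ⟨paths_of_mapsInto_sub hj hAR, paths_of_mapsInto_sub hRr hRA⟩)
      (fun π π' => ⟨rel_of_mapsInto_sub hj hAR, rel_of_mapsInto_sub hRr hRA⟩)
      (fun π => le_antisymm (typ_of_mapsInto_sub hj hAR π) (typ_of_mapsInto_sub hRr hRA π))
  -- The closure of a coherent structure maps back into it, so B has no more than the plain
  -- replacement.
  have hBrep : MapsInto id B.toPreAMRS (preReplace A.toPreAMRS j R.toPreAMRS hj hR) := by
    rw [h5]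
    exact (MapsInto.refl _).closure hrep
  have hBR : MapsInto id (B.sub j (j + R.len - 2)) R.toPreAMRS := by
    have key : MapsInto id (B.sub j (j + R.len - 2))
        (R.unify (Set.Icc 1 (R.len - 1)) (B.sub j (j + R.len - 2))) := by
      refine mapsInto_unifyVia_right fun i hi hi' => ?_
      replace hi' : i ≤ min (j + R.len - 2) B.len - (j - 1) := hi'
      dsimp only [id]
      exact ⟨by omega, Set.mem_Icc.2 (by omega), rfl⟩
    rwa [← h4] at key
  have hbody : ∀ l, 1 ≤ l → l ≤ R.len - 1 →
      HasComplete θ Cat G ws (t (l - 1 + (j - 1))) (t (l + (j - 1))) R.toPreAMRS l := by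
    intro l hl hl'
    have h6 := hX (l + (j - 1)) (by omega) (by omega)
    rw [show l + (j - 1) - 1 = l - 1 + (j - 1) by omega] at h6
    refine h6.mono fun X _ hXB => ?_
    refine hBR.comp (hXB.sub (h := fun _ => l) fun i _ _ hle => ⟨?_, rfl⟩)
    omega
  have hhead := hasComplete_head hρ hρR hRcons hR (s := fun i => t (i + (j - 1)))
    (tle _ (by omega)) hbody
  -- The r - 1 body positions of B, r = `R.len`, collapse to position j of A. Later positions differ
  -- by r - 2, and the merged interval runs from t (j - 1) to t (j + r - 2).
  refine ⟨fun l => if l < j then t l else t (l + R.len - 2), ?_, ?_, ?_, ?_⟩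
  · dsimp only
    rw [if_pos (by omega), t0]
  · dsimp only
    rw [if_neg (by omega), ← hBlen, tlen]
  · intro l hl
    dsimp only
    split_ifs
    · exact tle _ (by omega)
    · exact tle _ (by omega)
  · intro l hl hl'
    dsimp only
    rcases lt_trichotomy l j with hlt | rfl | hgt
    · rw [if_pos hlt, if_pos (by omega)]
      refine (hX l hl (by omega)).mono fun X _ hXB => ?_
      exact (hBrep.comp hXB).of_preReplace (if_pos hlt)
    · rw [if_neg (lt_irrefl l), if_pos (by omega)]
      rw [Nat.zero_add, show R.len - 1 + (l - 1) = l + R.len - 2 by omega] at hhead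
      refine hhead.mono fun X hX1 hXR => ?_
      -- The item is part of the head of R, hence of the head taken alone as index 1, which is
      -- contained in A at j.
      refine hRA.comp (hXR.sub (j := R.len) (k := R.len) (h := fun _ => 1) fun i _ _ _ => ?_)
      omega
    · rw [if_neg (by omega), if_neg (by omega)]
      have h6 := hX (l + R.len - 2) (by omega) (by omega)
      rw [show l + R.len - 2 - 1 = l - 1 + R.len - 2 by omega] at h6
      refine h6.mono fun X _ hXB => (hBrep.comp hXB).of_preReplace ?_
      dsimp only [id]
      unfold origin
      rw [if_neg (by omega), if_neg (by omega), show l + R.len - 2 + 2 - R.len = l by omega]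

/-! ### Recognition of the input -/

theorem foldr_concat_len (As : List (TFS Feats Nodes)) :
    ((As.map (TFS.abs θ)).foldr concat empty : PreAMRS Feats Types).len = As.length := by
  induction As with
  | nil => rfl
  | cons A As ih =>
    show 1 + _ = _
    rw [ih, List.length_cons, Nat.add_comm]

theorem mapsInto_foldr_concat (As : List (TFS Feats Nodes)) (l : ℕ) (hl : l < As.length) :
    MapsInto (fun _ => l + 1) (As[l].abs θ)
      ((As.map (TFS.abs θ)).foldr concat empty : PreAMRS Feats Types) := by
  have hone : ∀ A : TFS Feats Nodes, (A.abs θ : PreAMRS Feats Types).len = 1 := fun _ => rfl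
  induction As generalizing l with
  | nil => exact absurd hl (Nat.not_lt_zero _)
  | cons A As ih =>
    cases l with
    | zero =>
      refine (mapsInto_concat_left _ _).congr fun i h1 h2 => ?_
      exact le_antisymm h2 h1
    | succ l =>
      -- The tail is shifted by the length of the first structure, which is 1.
      exact (mapsInto_concat_right (A.abs θ) _).comp (ih l (by simpa using hl))

theorem recognized_of_mem_PT {B : PreAMRS Feats Types} (hB : B ∈ PT θ Cat ws 1 ws.length) :
    Recognized θ Cat G ws B := by
  obtain ⟨As, hAs, rfl⟩ := hB
  rw [Nat.sub_self, List.drop_zero, Nat.add_sub_cancel, List.take_length] at hAs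
  have hlen : As.length = ws.length := hAs.length_eq
  -- Each element is a category of one word, so the l-th interval runs from l - 1 to l.
  refine ⟨id, rfl, (foldr_concat_len As).trans hlen, fun l hl => ?_, fun l hl hl' => ?_⟩
  · rw [foldr_concat_len, hlen] at hl
    exact hl
  · rw [foldr_concat_len] at hl'
    obtain ⟨l, rfl⟩ : ∃ k, l = k + 1 := ⟨l - 1, by omega⟩
    refine ⟨⟨l, As[l].toMRS.absAMRS θ, l + 1, .comp, Nat.le_succ l⟩,
      parseStep_chart Set.finite_empty (Set.empty_subset _)
        (Or.inr (Or.inr (Or.inr (Or.inr ⟨l, by omega, As[l], ?_, rfl, rfl, rfl, rfl⟩)))),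
      rfl, rfl, rfl, rfl, mapsInto_foldr_concat As l (by omega)⟩
    exact hAs.get (by omega) (by omega)

theorem Recognized.of_subsumes {B B' : PreAMRS Feats Types} (hB : Recognized θ Cat G ws B)
    (h : B.Subsumes B') : Recognized θ Cat G ws B' := by
  obtain ⟨t, t0, tlen, tle, hX⟩ := hB
  have hl := h.1
  exact ⟨t, t0, hl ▸ tlen, hl ▸ tle, fun l h1 h2 =>
    (hX l h1 (hl ▸ h2)).mono fun X _ hXB => h.mapsInto.comp hXB⟩

end Parsing

end TFSParsing

/-! ### From a derivation to a successful computation -/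

theorem mainTheorem9 {Feats : Type*} [Finite Feats] {Types : Type*} [CompleteLattice Types]
    [Finite Types] {Nodes : Type*} (θ : Nodes → Types) {Words : Type*}
    (Cat : Words → Set (TFSParsing.TFS Feats Nodes)) (G : TFSParsing.Grammar Feats Nodes)
    (w : List Words) (hw : w ∈ TFSParsing.language θ Cat G) :
    TFSParsing.Successful θ Cat G w := by
  obtain ⟨B, hB, A', B', hlen, hcons, hsub, hder⟩ := hw
  have hB' := (TFSParsing.recognized_of_mem_PT (G := G) hB).of_subsumes hsub
  have hA' : TFSParsing.Recognized θ Cat G w A'.toPreAMRS := by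
    clear hcons hlen
    induction hder using Relation.ReflTransGen.head_induction_on with
    | refl => exact hB'
    | head h _ ih => exact h.recognized ih
  obtain ⟨t, t0, tlen, -, hX⟩ := hA'
  have h1 : A'.len = 1 := hlen
  obtain ⟨x, hx, hi, hj, hc, hl, hXA⟩ := hX 1 le_rfl h1.ge
  obtain ⟨m, hm⟩ := Set.mem_iUnion.1 hx
  rw [h1] at tlen
  refine ⟨m, x, hm, hi.trans t0, hj.trans tlen, hc, hl, fun hinc => hcons ?_⟩
  -- Both the item (through A') and Abs(A_s) are parts of the coherent structure Abs(A_s) ⊔ A', so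
  -- their unification is too. If it failed, so would Abs(A_s) ⊔ A'.
  have hAU : TFSParsing.PreAMRS.MapsInto id A'.toPreAMRS
      (TFSParsing.PreAMRS.unify (G.start.abs θ) (Set.Icc 1 1) A'.toPreAMRS) :=
    TFSParsing.PreAMRS.mapsInto_unifyVia_right fun i h2 h3 =>
      ⟨⟨h2, h3.trans h1.le⟩, ⟨h2, h3.trans h1.le⟩, rfl⟩
  have hSU := TFSParsing.PreAMRS.mapsInto_unifyVia_left id (G.start.abs θ) (Set.Icc 1 1)
    A'.toPreAMRS
  exact ((hAU.comp hXA).unifyVia (f := fun _ => 1) (J := {1}) hSU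
    (TFSParsing.PreAMRS.unifyVia_coherent _ _ _ _) fun _ _ _ _ => rfl).inconsistent hinc
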